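/- **Setting.** Let $n,H,S,A_1,\dots,A_n\ge 1$ be integers, $\mathcal S=\{1,\dots,S\}$, $\mathcal A_i=\{1,\dots,A_i\}$, $\mathcal A=\prod_i\mathcal A_i$, and let $\Delta(X)$ denote the probability distributions on a finite set $X$. A finite-horizon $n$-agent robust Markov game with total-variation uncertainty consists of a nominal kernel $P^0=(P^0_h)_{h\le H}$ with $P^0_{h,s,a}=P^0_h(\cdot\mid s,a)\in\Delta(\mathcal S)$, rewards $r_{i,h}:\mathcal S\times\mathcal A\to[0,1]$, and uncertainty levels $\sigma_i\in(0,1]$. For $p \in \Delta(\mathcal S)$ put $\mathcal U^{\sigma}(p)=\{q\in\Delta(\mathcal S):\tfrac12\|q-p\|_1\le\sigma\}$, and let $\mathcal U_i=\prod_{h,s,a}\mathcal U^{\sigma_i}(P^0_{h,s,a})$ be the uncertainty set of agent $i$. A joint (Markov) policy is $\pi=(\pi_h)_{h\le H}$ with $\pi_h:\mathcal S\to\Delta(\mathcal A)$. Let $V_i^{\pi,P}(s)=\mathbb E_{\pi,P}\big[\sum_{t=1}^H r_{i,t}(s_t,a_t)\mid s_1=s\big]$, where $a_t\sim\pi_t(\cdot\mid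 s_t)$ and $s_{t+1}\sim P_t(\cdot\mid s_t,a_t)$, and let $V_i^{\pi}(s)=\inf_{P\in\mathcal U_i}V_i^{\pi,P}(s)$ be the robust value at the first step. For $\pi_i'=(\pi'_{i,h})_{h\le H}$ with $\pi'_{i,h}:\mathcal S\to\Delta(\mathcal A_i)$, let $\pi_i'\times\pi_{-i}$ be the joint policy in which agent $i$ plays $\pi'_i$ independently of the others, who play the marginal $\pi_{-i}$ of $\pi$. For $f=(f_{h,s})$ with $f_{h,s}:\mathcal A_i\to\mathcal A_i$, let $f\diamond\pi$ be the joint policy in which agent $i$ plays $f_{h,s}(a_i)$ whenever $\pi_h(\cdot\mid s)$ draws $a$. A joint policy $\pi$ is an $\varepsilon$-robust CCE if $\max_{s,i}\{\sup_{\pi_i'}V_i^{\pi_i'\times\pi_{-i}}(s)-V_i^\pi(s)\}\le\varepsilon$; it is an $\varepsilon$-robust NE if in addition it is a product policy (every $\pi_h(\cdot\mid s)$ is a product of distributions on $\mathcal A_1,\dots,\mathcal A_n$); it is an $\varepsilon$-robust CE if $\max_{s,i}\{\max_{f}V_i^{f\diamond\pi}(s)-V_i^\pi(s)\}\le\varepsilon$.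 **Data and algorithm.** A generative model supplies, for each $(h,s,a)$, $N\ge1$ samples from $P^0_h(\cdot\mid s,a)$, all samples being independent; the total number of samples is $N_{\mathsf{all}}=NHS\prod_iA_i$. Let $\widehat P^0$ be the kernel of empirical frequencies. DR-NVI starts from $\widehat V_{i,H+1}=0$ and computes, for $h=H,\dots,1$ and all $i,s,a$, $$\widehat Q_{i,h}(s,a)=r_{i,h}(s,a)+\inf_{q\in\mathcal U^{\sigma_i}(\widehat P^0_{h,s,a})}\sum_{s'}q(s')\widehat V_{i,h+1}(s'),$$ $$\widehat\pi_h(\cdot\mid s)=\mathsf{Equilibrium}\big((\widehat Q_{j,h}(s,\cdot))_{j\le n}\big),\qquad \widehat V_{i,h}(s)=\mathbb E_{a\sim\widehat\pi_h(\cdot\mid s)}[\widehat Q_{i,h}(s,a)],$$ and outputs $\widehat\pi=(\widehat\pi_h)_{h\le H}$. Here $\mathsf{Equilibrium}$ is any fixed (deterministic) map which sends each $n$-tuple of payoff functions on $\mathcal A$ to a mixed Nash equilibrium ($\mathsf{Compute\text{-}Nash}$), a coarse correlated equilibrium ($\mathsf{Compute\text{-}CCE}$) or a correlated equilibrium ($\mathsf{Compute\text{-}CE}$)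 of that one-shot game. **Theorem.** There is a universal constant $C_1>0$ such that the following holds for every such game, every $N\ge1$, every $\delta\in(0,1)$ and every $0<\varepsilon\le\sqrt{\min\{H,1/\min_i\sigma_i\}}$. If $$N_{\mathsf{all}}=NHS\prod_{i}A_i\ \ge\ \frac{C_1\,S\,H^3\prod_{i}A_i}{\varepsilon^2}\,\min\Big\{H,\frac1{\min_i\sigma_i}\Big\}\,\log\Big(\frac{18\,S\prod_{i}A_i\,nHN}{\delta}\Big),$$ then, with probability at least $1-\delta$, the output $\widehat\pi$ of DR-NVI is an $\varepsilon$-robust NE if $\mathsf{Equilibrium}$ is $\mathsf{Compute\text{-}Nash}$; likewise, with probability at least $1-\delta$, it is an $\varepsilon$-robust CCE if $\mathsf{Equilibrium}$ is $\mathsf{Compute\text{-}CCE}$, and, with probability at least $1-\delta$, it is an $\varepsilon$-robust CE if $\mathsf{Equilibrium}$ is $\mathsf{Compute\text{-}CE}$. -/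

import Mathlib

open MeasureTheory ProbabilityTheory

/-- Joint action profiles: agent `i` has the action space `{0, …, A i - 1}`. -/
abbrev JointAction {n : ℕ} (A : Fin n → ℕ) : Type := (i : Fin n) → Fin (A i)

namespace JointDist

variable {n : ℕ} {A : Fin n → ℕ}

/-- Expectation of `q` when the joint action is drawn from `μ`. -/
def expect (μ : stdSimplex ℝ (JointAction A)) (q : JointAction A → ℝ) : ℝ :=
  ∑ a, μ.1 a * q a

/-- `μ` is a product distribution: the agents act independently. -/
def IsProduct (μ : stdSimplex ℝ (JointAction A)) : Prop :=
  ∃ ν : (i : Fin n) → stdSimplex ℝ (Fin (A i)), ∀ a, μ.1 a = ∏ i, (ν i).1 (a i)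

/-- The marginal of `μ` on the actions of the agents other than `i`, written as a function of a
joint action whose `i`-th coordinate is ignored. -/
def marginalOthers (μ : stdSimplex ℝ (JointAction A)) (i : Fin n) (a : JointAction A) : ℝ :=
  ∑ b : Fin (A i), μ.1 (Function.update a i b)

/-- The swap of `a i` with `b` on pairs `(a, b)`. -/
def swapAt (i : Fin n) : (JointAction A × Fin (A i)) ≃ (JointAction A × Fin (A i)) where
  toFun p := (Function.update p.1 i p.2, p.1 i)
  invFun p := (Function.update p.1 i p.2, p.1 i)
  left_inv p := by simp
  right_inv p := by simp

/-- `ν × μ₋ᵢ`: agent `i` draws its action from `ν`, independently of the others, who draw theirs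
from the marginal `μ₋ᵢ` of `μ`. -/
def replaceAgent (μ : stdSimplex ℝ (JointAction A)) (i : Fin n)
    (ν : stdSimplex ℝ (Fin (A i))) : stdSimplex ℝ (JointAction A) :=
  ⟨fun a => ν.1 (a i) * marginalOthers μ i a, by
    refine ⟨fun a => mul_nonneg (ν.2.1 _) (Finset.sum_nonneg fun b _ => μ.2.1 _), ?_⟩
    have h1 : ∑ a : JointAction A, ν.1 (a i) * marginalOthers μ i a
        = ∑ p : JointAction A × Fin (A i), ν.1 (p.1 i) * μ.1 (Function.update p.1 i p.2) := by
      rw [Fintype.sum_prod_type]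
      simp [marginalOthers, Finset.mul_sum]
    have h2 : ∑ p : JointAction A × Fin (A i), ν.1 (p.1 i) * μ.1 (Function.update p.1 i p.2)
        = ∑ p : JointAction A × Fin (A i), ν.1 p.2 * μ.1 p.1 :=
      Fintype.sum_equiv (swapAt i) _ _ (fun p => rfl)
    rw [h1, h2, Fintype.sum_prod_type]
    simp only [← Finset.sum_mul]
    rw [ν.2.2]
    simpa using μ.2.2⟩

/-- `f ⋄ μ`: whenever `μ` draws `a`, agent `i` plays `f (a i)` instead of `a i`. -/
def modifyAgent (μ : stdSimplex ℝ (JointAction A)) (i : Fin n)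
    (f : Fin (A i) → Fin (A i)) : stdSimplex ℝ (JointAction A) :=
  ⟨fun a => ∑ b : JointAction A, if Function.update b i (f (b i)) = a then μ.1 b else 0, by
    refine ⟨fun a => Finset.sum_nonneg fun b _ => ?_, ?_⟩
    · split_ifs
      · exact μ.2.1 b
      · exact le_rfl
    · rw [Finset.sum_comm]
      simpa using μ.2.2⟩

/-- `μ` is a (mixed) Nash equilibrium of the one-shot game with payoffs `q`. -/
def IsNash (q : Fin n → JointAction A → ℝ) (μ : stdSimplex ℝ (JointAction A)) : Prop :=
  IsProduct μ ∧
    ∀ (i : Fin n) (ν : stdSimplex ℝ (Fin (A i))),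
      expect (replaceAgent μ i ν) (q i) ≤ expect μ (q i)

/-- `μ` is a coarse correlated equilibrium of the one-shot game with payoffs `q`. -/
def IsCCE (q : Fin n → JointAction A → ℝ) (μ : stdSimplex ℝ (JointAction A)) : Prop :=
  ∀ (i : Fin n) (ν : stdSimplex ℝ (Fin (A i))),
    expect (replaceAgent μ i ν) (q i) ≤ expect μ (q i)

/-- `μ` is a correlated equilibrium of the one-shot game with payoffs `q`. -/
def IsCE (q : Fin n → JointAction A → ℝ) (μ : stdSimplex ℝ (JointAction A)) : Prop :=
  ∀ (i : Fin n) (f : Fin (A i) → Fin (A i)),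
    expect (modifyAgent μ i f) (q i) ≤ expect μ (q i)

end JointDist

/-- Joint Markov policies `π_h(· | s)`. Steps are numbered `0, …, H - 1`. -/
abbrev JointPolicy {n : ℕ} (H S : ℕ) (A : Fin n → ℕ) : Type :=
  Fin H → Fin S → stdSimplex ℝ (JointAction A)

/-- Transition arrays `P_h(s' | s, a)`, not yet required to be stochastic. -/
abbrev TransitionArray {n : ℕ} (H S : ℕ) (A : Fin n → ℕ) : Type :=
  Fin H → Fin S → JointAction A → Fin S → ℝ

/-- An equilibrium subroutine: a map from the payoffs of a one-shot game to a distribution over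
joint actions. -/
abbrev EquilibriumRoutine {n : ℕ} (A : Fin n → ℕ) : Type :=
  (Fin n → JointAction A → ℝ) → stdSimplex ℝ (JointAction A)

/-- The probability vectors within total variation distance `σ` of `p`. -/
def tvBall {S : ℕ} (σ : ℝ) (p : Fin S → ℝ) : Set (Fin S → ℝ) :=
  {q | q ∈ stdSimplex ℝ (Fin S) ∧ (1 / 2) * ∑ s, |q s - p s| ≤ σ}

/-- A finite-horizon robust Markov game with total variation uncertainty sets: nominal transition
kernel, rewards in `[0, 1]`, and one positive uncertainty level for each agent. -/
structure RobustMarkovGame (n H S : ℕ) (A : Fin n → ℕ) where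
  nominal : TransitionArray H S A
  nominal_mem : ∀ h s a, nominal h s a ∈ stdSimplex ℝ (Fin S)
  reward : Fin n → Fin H → Fin S → JointAction A → ℝ
  reward_mem : ∀ i h s a, reward i h s a ∈ Set.Icc (0 : ℝ) 1
  level : Fin n → ℝ
  level_pos : ∀ i, 0 < level i

namespace RobustMarkovGame

variable {n H S : ℕ} {A : Fin n → ℕ}

/-- Probability of the trajectory `τ = ((s_0, a_0), …, (s_{H-1}, a_{H-1}))` started at `s₀`, where
`a_t ∼ π_t(· | s_t)` and `s_{t+1} ∼ P_t(· | s_t, a_t)`. -/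
def trajProb (π : JointPolicy H S A) (P : TransitionArray H S A) (s₀ : Fin S)
    (τ : Fin H → Fin S × JointAction A) : ℝ :=
  ∏ t : Fin H,
    (if t.val = 0 then (if (τ t).1 = s₀ then 1 else 0)
      else
        P ⟨t.val - 1, lt_of_le_of_lt (Nat.sub_le _ _) t.isLt⟩
          (τ ⟨t.val - 1, lt_of_le_of_lt (Nat.sub_le _ _) t.isLt⟩).1
          (τ ⟨t.val - 1, lt_of_le_of_lt (Nat.sub_le _ _) t.isLt⟩).2
          (τ t).1)
      * (π t (τ t).1).1 (τ t).2

/-- Value of agent `i` at the first step, under the policy `π` and the transition kernel `P`: the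
expected total reward along the random trajectory started at `s`. -/
def value (G : RobustMarkovGame n H S A) (π : JointPolicy H S A) (P : TransitionArray H S A)
    (i : Fin n) (s : Fin S) : ℝ :=
  ∑ τ : Fin H → Fin S × JointAction A,
    trajProb π P s τ * ∑ t : Fin H, G.reward i t (τ t).1 (τ t).2

/-- The `(s, a)`-rectangular uncertainty set of agent `i`. -/
def uncertaintySet (G : RobustMarkovGame n H S A) (i : Fin n) : Set (TransitionArray H S A) :=
  {P | ∀ h s a, P h s a ∈ tvBall (G.level i) (G.nominal h s a)}

/-- Robust value of agent `i` at the first step: the worst case over its uncertainty set. -/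
noncomputable def robustValue (G : RobustMarkovGame n H S A) (π : JointPolicy H S A)
    (i : Fin n) (s : Fin S) : ℝ :=
  ⨅ P : G.uncertaintySet i, G.value π P.1 i s

/-- The joint policy `π'_i × π₋ᵢ`. -/
def deviate (π : JointPolicy H S A) (i : Fin n)
    (π' : Fin H → Fin S → stdSimplex ℝ (Fin (A i))) : JointPolicy H S A :=
  fun h s => JointDist.replaceAgent (π h s) i (π' h s)

/-- The joint policy `f_i ⋄ π`. -/
def strategyModify (π : JointPolicy H S A) (i : Fin n)
    (f : Fin H → Fin S → Fin (A i) → Fin (A i)) : JointPolicy H S A :=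
  fun h s => JointDist.modifyAgent (π h s) i (f h s)

/-- Best robust value of agent `i` at the first step against `π₋ᵢ`. -/
noncomputable def bestResponseValue (G : RobustMarkovGame n H S A) (π : JointPolicy H S A)
    (i : Fin n) (s : Fin S) : ℝ :=
  ⨆ π' : Fin H → Fin S → stdSimplex ℝ (Fin (A i)), G.robustValue (deviate π i π') i s

/-- Best robust value of agent `i` at the first step over all strategy modifications of `π`. -/
noncomputable def bestModifiedValue (G : RobustMarkovGame n H S A) (π : JointPolicy H S A)
    (i : Fin n) (s : Fin S) : ℝ :=
  ⨆ f : Fin H → Fin S → Fin (A i) → Fin (A i), G.robustValue (strategyModify π i f) i s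

/-- The gap of NE and of CCE: the two differ only in the class of policies. -/
noncomputable def gapResponse (G : RobustMarkovGame n H S A) (π : JointPolicy H S A) : ℝ :=
  ⨆ x : Fin n × Fin S, (G.bestResponseValue π x.1 x.2 - G.robustValue π x.1 x.2)

/-- The gap of CE. -/
noncomputable def gapCE (G : RobustMarkovGame n H S A) (π : JointPolicy H S A) : ℝ :=
  ⨆ x : Fin n × Fin S, (G.bestModifiedValue π x.1 x.2 - G.robustValue π x.1 x.2)

/-- `ε`-robust Nash equilibrium: a product policy with gap at most `ε`. -/
def IsRobustNE (G : RobustMarkovGame n H S A) (ε : ℝ) (π : JointPolicy H S A) : Prop :=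
  (∀ h s, JointDist.IsProduct (π h s)) ∧ G.gapResponse π ≤ ε

/-- `ε`-robust coarse correlated equilibrium. -/
def IsRobustCCE (G : RobustMarkovGame n H S A) (ε : ℝ) (π : JointPolicy H S A) : Prop :=
  G.gapResponse π ≤ ε

/-- `ε`-robust correlated equilibrium. -/
def IsRobustCE (G : RobustMarkovGame n H S A) (ε : ℝ) (π : JointPolicy H S A) : Prop :=
  G.gapCE π ≤ ε

/-- A data set: the `k`-th of the `N` next states observed for each step, state, joint action. -/
abbrev Dataset (N H S : ℕ) {n : ℕ} (A : Fin n → ℕ) : Type :=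
  Fin N → Fin H → Fin S → JointAction A → Fin S

/-- The random data set `X` consists of `N` draws from the generative model for each step, state
and joint action, all of them independent, each with the nominal law. -/
structure IsGenerativeSample (G : RobustMarkovGame n H S A) {N : ℕ} {Ω : Type*}
    [MeasurableSpace Ω] (μ : Measure Ω) (X : Ω → Dataset N H S A) : Prop where
  measurable : ∀ k h s a, Measurable fun ω => X ω k h s a
  indep : iIndepFun
    (fun (x : Fin N × Fin H × Fin S × JointAction A) ω => X ω x.1 x.2.1 x.2.2.1 x.2.2.2) μ
  law : ∀ k h s a s', μ.real {ω | X ω k h s a = s'} = G.nominal h s a s'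

/-- Empirical frequencies of the transitions in the data set `D`. -/
noncomputable def empirical {N : ℕ} (D : Dataset N H S A) : TransitionArray H S A :=
  fun h s a s' => (1 / (N : ℝ)) * ∑ k : Fin N, if D k h s a = s' then 1 else 0

/-- `inf` of `q · V` over the probability vectors `q` in the total variation ball around `p`. -/
noncomputable def worstCase (σ : ℝ) (p V : Fin S → ℝ) : ℝ :=
  ⨅ q : tvBall σ p, ∑ s, q.1 s * V s

/-- One update of the robust Q-function at step `h` and state `s` from the next value estimate. -/
noncomputable def nviQStep (G : RobustMarkovGame n H S A) (P : TransitionArray H S A)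
    (V : Fin n → Fin S → ℝ) (h : Fin H) (s : Fin S) : Fin n → JointAction A → ℝ :=
  fun i a => G.reward i h s a + worstCase (G.level i) (P h s a) (V i)

/-- The value estimates of DR-NVI run on the transition array `P` with the equilibrium subroutine
`E`, computed backwards in time from zero values after the last step. -/
noncomputable def nviV (G : RobustMarkovGame n H S A) (P : TransitionArray H S A)
    (E : EquilibriumRoutine A) (h : ℕ) : Fin n → Fin S → ℝ :=
  if hh : h < H then fun i s =>
    JointDist.expect (E (G.nviQStep P (G.nviV P E (h + 1)) ⟨h, hh⟩ s))
      (G.nviQStep P (G.nviV P E (h + 1)) ⟨h, hh⟩ s i)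
  else fun _ _ => 0
termination_by H - h

/-- The Q-function estimates of DR-NVI. -/
noncomputable def nviQ (G : RobustMarkovGame n H S A) (P : TransitionArray H S A)
    (E : EquilibriumRoutine A) (h : Fin H) (s : Fin S) : Fin n → JointAction A → ℝ :=
  G.nviQStep P (G.nviV P E (h.val + 1)) h s

/-- The policy output by DR-NVI on the data set `D` with the equilibrium subroutine `E`. -/
noncomputable def drNVI (G : RobustMarkovGame n H S A) (E : EquilibriumRoutine A) {N : ℕ}
    (D : Dataset N H S A) : JointPolicy H S A :=
  fun h s => E (G.nviQ (empirical D) E h s)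

/-- `min {H, 1 / min_i σ_i}`. -/
noncomputable def effectiveHorizon (G : RobustMarkovGame n H S A) : ℝ :=
  min (H : ℝ) (1 / ⨅ i, G.level i)

end RobustMarkovGame

/-!
The proof compares the true robust values with the value estimates `V̂` of DR-NVI, never with
optimal robust values, so that neither the robust Bellman equation nor the existence of a robust
best response is needed.

*One-step errors.* Let `b_h(s, a)` be the change of the worst case expectation of `V̂_{h+1}` when the
nominal transition law is replaced by the empirical one. By duality for total variation balls
(`RobustMarkovGame.dual_le_worstCase`, `RobustMarkovGame.exists_worstCase_le_dual`) it is at most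
the deviation of the empirical mean of a truncation of `V̂_{h+1}` at one of its own values, so that
a union over `S` truncation levels replaces a net. As `V̂_{h+1}` is a function of the samples at later
steps, it is independent of the samples at step `h`, and a Chernoff bound with a fixed exponent `λ`
gives `b_h ≤ λ Var(V̂_{h+1}) + τ / (N λ)` outside an event of probability `2 exp (-τ)`
(`RobustMarkovGame.le_measureReal_worstCase_error`).

*Oscillation.* An adversary who may move mass `σ` to the worst state shrinks the oscillation of the
next value by `1 - σ`. So `V̂` oscillates by at most `M = min {H, 1 / σ}`
(`RobustMarkovGame.nviV_sub_le`), and changing the kernel within the uncertainty set changes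
variances of `V̂` by at most `σ M ^ 2 ≤ M`.

*Accumulation.* Let `W_h ∈ [0, M]` be the distance of `V̂_h` from its maximum or minimum. It satisfies
`W_h ≤ E[q W_{h+1}] + 1 + b_h` along the trajectory under consideration, hence `2 λ W ^ 2` is
a potential whose drift absorbs the terms `λ Var_q(W_{h+1})` at the cost of order `λ M` per step
(`le_of_potential`). This takes the place of the law of total variance. With `λ = ε / (24 H M)` both
`H λ M` and, by the sample size condition, `H τ / (N λ)` are of order `ε`.

*Conclusion.* The equilibrium property of the one-shot games says that a deviation does not increase
the expectation of the estimated payoffs. Therefore its robust value exceeds `V̂_1` by at most the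
accumulated error (`RobustMarkovGame.robustValue_le_nviV`: it suffices to evaluate it under the
kernel that is worst for `V̂`), while the robust value of the output is at least `V̂_1` minus the
accumulated error (`RobustMarkovGame.nviV_le_robustValue`, for each kernel separately).
-/

/-! ### Expectation and variance under probability vectors -/

/-- Variance of `f` under the probability vector `p`. -/
def finVar {S : ℕ} (p f : Fin S → ℝ) : ℝ := ∑ s, p s * (f s - p ⬝ᵥ f) ^ 2

section ProbabilityVectors

variable {S : ℕ} {p q f : Fin S → ℝ} {σ a b c : ℝ}

lemma dotProduct_le_of_forall_le (hp : p ∈ stdSimplex ℝ (Fin S)) (hf : ∀ s, f s ≤ b) :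
    p ⬝ᵥ f ≤ b := by
  calc p ⬝ᵥ f ≤ ∑ s, p s * b := Finset.sum_le_sum fun s _ =>
        mul_le_mul_of_nonneg_left (hf s) (hp.1 s)
    _ = b := by rw [← Finset.sum_mul, hp.2, one_mul]

lemma le_dotProduct_of_forall_le (hp : p ∈ stdSimplex ℝ (Fin S)) (hf : ∀ s, a ≤ f s) :
    a ≤ p ⬝ᵥ f := by
  calc a = ∑ s, p s * a := by rw [← Finset.sum_mul, hp.2, one_mul]
    _ ≤ p ⬝ᵥ f := Finset.sum_le_sum fun s _ => mul_le_mul_of_nonneg_left (hf s) (hp.1 s)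

lemma dotProduct_mono (hp : p ∈ stdSimplex ℝ (Fin S)) {g : Fin S → ℝ} (h : ∀ s, f s ≤ g s) :
    p ⬝ᵥ f ≤ p ⬝ᵥ g :=
  Finset.sum_le_sum fun s _ => mul_le_mul_of_nonneg_left (h s) (hp.1 s)

lemma dotProduct_const_sub (hp : p ∈ stdSimplex ℝ (Fin S)) :
    (p ⬝ᵥ fun s => c - f s) = c - p ⬝ᵥ f := by
  simp only [dotProduct, mul_sub, Finset.sum_sub_distrib, ← Finset.sum_mul, hp.2, one_mul]

lemma dotProduct_sub_const (hp : p ∈ stdSimplex ℝ (Fin S)) :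
    (p ⬝ᵥ fun s => f s - c) = p ⬝ᵥ f - c := by
  simp only [dotProduct, mul_sub, Finset.sum_sub_distrib, ← Finset.sum_mul, hp.2, one_mul]

/-- Expectations of a function with oscillation at most `b - a` differ by at most `σ (b - a)`
between probability vectors within total variation `σ`. -/
lemma sub_dotProduct_le_of_tv (hp : p ∈ stdSimplex ℝ (Fin S)) (hq : q ∈ stdSimplex ℝ (Fin S))
    (hpq : (1 / 2) * ∑ s, |q s - p s| ≤ σ) (hab : a ≤ b)
    (ha : ∀ s, a ≤ f s) (hb : ∀ s, f s ≤ b) :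
    (q - p) ⬝ᵥ f ≤ σ * (b - a) := by
  have h0 : (q - p) ⬝ᵥ f = ∑ s, (q s - p s) * (f s - (a + b) / 2) := by
    have : ∑ s, (q s - p s) * ((a + b) / 2) = 0 := by
      rw [← Finset.sum_mul, Finset.sum_sub_distrib, hp.2, hq.2]; ring
    simp only [mul_sub, Finset.sum_sub_distrib, this, sub_zero]
    rfl
  have h1 : ∑ s, (q s - p s) * (f s - (a + b) / 2) ≤ ∑ s, |q s - p s| * ((b - a) / 2) := by
    refine Finset.sum_le_sum fun s _ => ?_
    refine (le_abs_self _).trans ?_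
    rw [abs_mul]
    refine mul_le_mul_of_nonneg_left ?_ (abs_nonneg _)
    rw [abs_le]
    constructor <;> linarith [ha s, hb s]
  rw [← Finset.sum_mul] at h1
  rw [h0]
  nlinarith

lemma finVar_nonneg (hp : p ∈ stdSimplex ℝ (Fin S)) : 0 ≤ finVar p f :=
  Finset.sum_nonneg fun s _ => mul_nonneg (hp.1 s) (sq_nonneg _)

lemma sum_mul_sub_sq (hp : p ∈ stdSimplex ℝ (Fin S)) (c : ℝ) :
    ∑ s, p s * (f s - c) ^ 2 = finVar p f + (p ⬝ᵥ f - c) ^ 2 := by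
  have h : ∀ s, p s * (f s - c) ^ 2 = p s * (f s - p ⬝ᵥ f) ^ 2
      + (2 * (p ⬝ᵥ f - c)) * (p s * f s) + ((c ^ 2 - (p ⬝ᵥ f) ^ 2)) * p s := fun s => by ring
  simp only [h, Finset.sum_add_distrib, ← Finset.mul_sum, hp.2]
  change finVar p f + 2 * (p ⬝ᵥ f - c) * (p ⬝ᵥ f) + (c ^ 2 - (p ⬝ᵥ f) ^ 2) * 1 = _
  ring

lemma finVar_le_sum_mul_sub_sq (hp : p ∈ stdSimplex ℝ (Fin S)) (c : ℝ) :
    finVar p f ≤ ∑ s, p s * (f s - c) ^ 2 := by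
  rw [sum_mul_sub_sq hp]
  nlinarith [sq_nonneg (p ⬝ᵥ f - c)]

lemma sum_mul_sq (hp : p ∈ stdSimplex ℝ (Fin S)) :
    (p ⬝ᵥ fun s => f s ^ 2) = finVar p f + (p ⬝ᵥ f) ^ 2 := by
  simpa [dotProduct] using sum_mul_sub_sq (f := f) hp 0

lemma finVar_const_sub (hp : p ∈ stdSimplex ℝ (Fin S)) :
    finVar p (fun s => c - f s) = finVar p f := by
  unfold finVar
  rw [dotProduct_const_sub hp]
  exact Finset.sum_congr rfl fun s _ => by ring

lemma finVar_sub_const (hp : p ∈ stdSimplex ℝ (Fin S)) :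
    finVar p (fun s => f s - c) = finVar p f := by
  unfold finVar
  rw [dotProduct_sub_const hp]
  exact Finset.sum_congr rfl fun s _ => by ring

lemma finVar_neg : finVar p (-f) = finVar p f := by
  unfold finVar
  rw [dotProduct_neg]
  exact Finset.sum_congr rfl fun s _ => by simp only [Pi.neg_apply]; ring

/-- Truncation does not increase the variance. -/
lemma finVar_min_le (hp : p ∈ stdSimplex ℝ (Fin S)) (α : ℝ) :
    finVar p (fun s => min (f s) α) ≤ finVar p f := by
  refine (finVar_le_sum_mul_sub_sq hp (min (p ⬝ᵥ f) α)).trans ?_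
  refine Finset.sum_le_sum fun s _ => mul_le_mul_of_nonneg_left ?_ (hp.1 s)
  exact sq_le_sq.2 (by simpa using abs_min_sub_min_le_max (f s) α (p ⬝ᵥ f) α)

/-- Variances of a function of oscillation at most `b - a` differ by at most `σ (b - a) ^ 2`
between probability vectors within total variation `σ`. -/
lemma finVar_le_of_tv (hp : p ∈ stdSimplex ℝ (Fin S)) (hq : q ∈ stdSimplex ℝ (Fin S))
    (hpq : (1 / 2) * ∑ s, |q s - p s| ≤ σ) (ha : ∀ s, a ≤ f s) (hb : ∀ s, f s ≤ b) :
    finVar p f ≤ finVar q f + σ * (b - a) ^ 2 := by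
  have hqp : (1 / 2) * ∑ s, |p s - q s| ≤ σ := by simpa only [abs_sub_comm] using hpq
  have h1 := sub_dotProduct_le_of_tv (f := fun s => (f s - q ⬝ᵥ f) ^ 2) (a := 0)
    (b := (b - a) ^ 2) hq hp hqp (sq_nonneg _) (fun s => sq_nonneg _) (fun s => by
      have := dotProduct_le_of_forall_le hq hb
      have := le_dotProduct_of_forall_le hq ha
      refine sq_le_sq' ?_ ?_ <;> linarith [ha s, hb s])
  rw [sub_dotProduct] at h1
  have h2 := finVar_le_sum_mul_sub_sq (f := f) hp (q ⬝ᵥ f)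
  simp only [dotProduct] at h1 h2
  simp only [finVar, dotProduct] at h2 ⊢
  linarith

end ProbabilityVectors

/-! ### Worst cases over total variation balls -/

namespace RobustMarkovGame

section WorstCase

variable {S : ℕ} {p p' V : Fin S → ℝ} {σ m M : ℝ}

lemma mem_tvBall_self (hp : p ∈ stdSimplex ℝ (Fin S)) (hσ : 0 ≤ σ) : p ∈ tvBall σ p :=
  ⟨hp, by simpa using hσ⟩

lemma isCompact_tvBall (σ : ℝ) (p : Fin S → ℝ) : IsCompact (tvBall σ p) := by
  have h : Continuous fun q : Fin S → ℝ => (1 / 2 : ℝ) * ∑ s, |q s - p s| := by fun_prop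
  exact (isCompact_stdSimplex ℝ (Fin S)).inter_right (isClosed_le h continuous_const)

/-- The worst case over a total variation ball is attained. -/
lemma exists_worstCase_eq (hp : p ∈ stdSimplex ℝ (Fin S)) (hσ : 0 ≤ σ) (V : Fin S → ℝ) :
    ∃ q ∈ tvBall σ p, q ⬝ᵥ V = worstCase σ p V ∧ ∀ q' ∈ tvBall σ p, q ⬝ᵥ V ≤ q' ⬝ᵥ V := by
  obtain ⟨q, hq, hmin⟩ := (isCompact_tvBall σ p).exists_isMinOn ⟨p, mem_tvBall_self hp hσ⟩
    (f := fun q => q ⬝ᵥ V) (by unfold dotProduct; fun_prop)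
  refine ⟨q, hq, le_antisymm ?_ ?_, hmin⟩
  · have : Nonempty (tvBall σ p) := ⟨⟨q, hq⟩⟩
    exact le_ciInf fun q' => hmin q'.2
  · exact ciInf_le ⟨q ⬝ᵥ V, by rintro _ ⟨q', rfl⟩; exact hmin q'.2⟩ (⟨q, hq⟩ : tvBall σ p)

lemma worstCase_le (hp : p ∈ stdSimplex ℝ (Fin S)) (hσ : 0 ≤ σ) {q : Fin S → ℝ}
    (hq : q ∈ tvBall σ p) : worstCase σ p V ≤ q ⬝ᵥ V := by
  obtain ⟨q₀, -, h, hmin⟩ := exists_worstCase_eq hp hσ V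
  exact h ▸ hmin q hq

lemma le_worstCase (hp : p ∈ stdSimplex ℝ (Fin S)) (hσ : 0 ≤ σ) {c : ℝ}
    (h : ∀ q ∈ tvBall σ p, c ≤ q ⬝ᵥ V) : c ≤ worstCase σ p V := by
  obtain ⟨q₀, hq, h', -⟩ := exists_worstCase_eq hp hσ V
  exact h' ▸ h q₀ hq

/-- Weak duality for the worst case over a total variation ball. -/
lemma dual_le_worstCase (hp : p ∈ stdSimplex ℝ (Fin S)) (hσ : 0 ≤ σ) (hm : ∀ s, m ≤ V s)
    {α : ℝ} (hα : m ≤ α) :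
    (p ⬝ᵥ fun s => min (V s) α) - σ * (α - m) ≤ worstCase σ p V := by
  refine le_worstCase hp hσ fun q hq => ?_
  have hq' : (1 / 2) * ∑ s, |p s - q s| ≤ σ := by simpa only [abs_sub_comm] using hq.2
  have h1 := sub_dotProduct_le_of_tv (f := fun s => min (V s) α) hq.1 hp hq' hα
    (fun s => le_min (hm s) hα) (fun s => min_le_right _ _)
  have h2 : (q ⬝ᵥ fun s => min (V s) α) ≤ q ⬝ᵥ V := dotProduct_mono hq.1 fun s => min_le_left _ _
  rw [sub_dotProduct] at h1
  linarith

/-- Moving the mass `r` of `p`, taken from the top of `V` down to the threshold `α`, to the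
minimiser `s₀` of `V` gives an upper bound on the worst case. -/
lemma worstCase_le_of_transport (hp : p ∈ stdSimplex ℝ (Fin S)) (hσ : 0 ≤ σ) (s₀ : Fin S)
    {α : ℝ} {r : Fin S → ℝ} (hr0 : ∀ s, 0 ≤ r s) (hrp : ∀ s, r s ≤ p s) (hr : ∑ s, r s ≤ σ)
    (htop : ∀ s, α < V s → r s = p s) (hbot : ∀ s, V s < α → r s = 0) :
    worstCase σ p V ≤ (p ⬝ᵥ fun s => min (V s) α) - (∑ s, r s) * (α - V s₀) := by
  set ρ := ∑ s, r s
  have hρ : 0 ≤ ρ := Finset.sum_nonneg fun s _ => hr0 s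
  have hδ : ∑ s, (if s = s₀ then ρ else 0) = ρ := by simp
  have hmem : (fun s => p s - r s + if s = s₀ then ρ else 0) ∈ tvBall σ p := by
    refine ⟨⟨fun s => add_nonneg (by linarith [hrp s]) (by split_ifs <;> simp [hρ]), ?_⟩, ?_⟩
    · rw [Finset.sum_add_distrib, Finset.sum_sub_distrib, hδ, hp.2]; simp [ρ]
    · have : ∑ s, |p s - r s + (if s = s₀ then ρ else 0) - p s|
          ≤ ∑ s, (r s + if s = s₀ then ρ else 0) := by
        refine Finset.sum_le_sum fun s _ => ?_
        have := hr0 s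
        split_ifs <;> rw [abs_le] <;> constructor <;> linarith
      rw [Finset.sum_add_distrib, hδ] at this
      linarith
  refine (worstCase_le hp hσ hmem).trans (le_of_eq ?_)
  have h1 : ∀ s, (p s - r s + if s = s₀ then ρ else 0) * V s
      = p s * min (V s) α - r s * α + (if s = s₀ then ρ * V s₀ else 0) := fun s => by
    have : (if s = s₀ then ρ else 0) * V s = (if s = s₀ then ρ * V s₀ else 0) := by
      split_ifs with h
      · rw [h]
      · simp
    rw [add_mul, this]
    rcases lt_trichotomy (V s) α with h | h | h
    · rw [hbot s h, min_eq_left h.le]; ring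
    · rw [h, min_self]; ring
    · rw [htop s h, min_eq_right h.le]; ring
  simp only [dotProduct, h1, Finset.sum_add_distrib, Finset.sum_sub_distrib, ← Finset.sum_mul]
  simp only [Finset.sum_ite_eq', Finset.mem_univ, if_true]
  ring

/-- Strong duality for the worst case over a total variation ball, in the form that the optimal
truncation level may be taken among the values of `V`. -/
lemma exists_worstCase_le_dual (hp : p ∈ stdSimplex ℝ (Fin S)) (hσ : 0 ≤ σ) (s₀ : Fin S)
    (hs₀ : ∀ s, V s₀ ≤ V s) :
    ∃ s₁, worstCase σ p V ≤ (p ⬝ᵥ fun s => min (V s) (V s₁)) - σ * (V s₁ - V s₀) := by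
  classical
  have : Nonempty (Fin S) := ⟨s₀⟩
  -- The optimal level is the least value of `V` above which `p` has mass at most `σ`.
  set T : Finset (Fin S) := {s | ∑ s' with V s < V s', p s' ≤ σ}
  have hT : T.Nonempty := by
    obtain ⟨s₂, h₂⟩ := Finite.exists_max V
    refine ⟨s₂, by simp [T, Finset.filter_eq_empty_iff.2 fun s _ => (h₂ s).not_gt, hσ]⟩
  obtain ⟨s₁, hs₁, hmin⟩ := T.exists_min_image V hT
  have hmass : ∑ s with V s₁ < V s, p s ≤ σ := by simpa [T] using hs₁
  refine ⟨s₁, ?_⟩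
  rcases (hs₀ s₁).eq_or_lt with heq | hlt
  · -- If that level is the minimum, all mass above it is moved.
    have := worstCase_le_of_transport (V := V) (α := V s₁) hp hσ s₀
      (r := fun s => if V s₁ < V s then p s else 0)
      (fun s => by split_ifs; exacts [hp.1 s, le_rfl])
      (fun s => by split_ifs; exacts [le_rfl, hp.1 s])
      (by rwa [← Finset.sum_filter])
      (fun s hs => if_pos hs) (fun s hs => if_neg hs.not_gt)
    rw [← heq] at this ⊢
    simpa using this
  · -- Otherwise the mass at the level itself is moved in part, so that `σ` is moved in total.
    have hmass' : σ < ∑ s with V s₁ ≤ V s, p s := by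
      obtain ⟨s₂, hs₂, hmax⟩ := ({s | V s < V s₁} : Finset (Fin S)).exists_max_image V
        ⟨s₀, by simpa using hlt⟩
      have h2 : V s₂ < V s₁ := by simpa using hs₂
      have h3 : s₂ ∉ T := fun h => (hmin s₂ h).not_gt h2
      have h4 : σ < ∑ s with V s₂ < V s, p s := by simpa [T] using h3
      refine h4.trans_eq (Finset.sum_congr (Finset.filter_congr fun s _ => ?_) fun _ _ => rfl)
      exact ⟨fun h => by_contra fun h' => (hmax s (by simpa using h')).not_gt h,
        fun h => h2.trans_le h⟩
    set a := ∑ s with V s₁ < V s, p s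
    set b := ∑ s with V s = V s₁, p s with hb
    have hab : ∑ s with V s₁ ≤ V s, p s = a + b := by
      simp only [a, b, Finset.sum_filter, ← Finset.sum_add_distrib]
      refine Finset.sum_congr rfl fun s _ => ?_
      rcases lt_trichotomy (V s) (V s₁) with h | h | h
      · simp [h.not_ge, h.not_gt, h.ne]
      · simp [h]
      · simp [h, h.le, h.ne']
    have hb0 : 0 < b := by linarith
    have hθ0 : 0 ≤ (σ - a) / b := div_nonneg (by linarith) hb0.le
    have hθ1 : (σ - a) / b ≤ 1 := by rw [div_le_one hb0]; linarith
    have hsum : ∑ s, ((if V s₁ < V s then p s else 0)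
        + if V s = V s₁ then (σ - a) / b * p s else 0) = σ := by
      rw [Finset.sum_add_distrib, ← Finset.sum_filter, ← Finset.sum_filter, ← Finset.mul_sum,
        ← hb, div_mul_cancel₀ _ hb0.ne']
      ring
    have hle : ∀ s, (σ - a) / b * p s ≤ p s := fun s => mul_le_of_le_one_left (hp.1 s) hθ1
    have := worstCase_le_of_transport (V := V) (α := V s₁) hp hσ s₀
      (r := fun s => (if V s₁ < V s then p s else 0)
        + if V s = V s₁ then (σ - a) / b * p s else 0)
      (fun s => add_nonneg (by split_ifs; exacts [hp.1 s, le_rfl])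
        (by split_ifs; exacts [mul_nonneg hθ0 (hp.1 s), le_rfl]))
      (fun s => by
        rcases lt_trichotomy (V s) (V s₁) with h | h | h
        · simp [h.not_gt, h.ne, hp.1 s]
        · simpa [h] using hle s
        · simp [h, h.ne'])
      hsum.le
      (fun s hs => by simp [hs, hs.ne']) (fun s hs => by simp [hs.not_gt, hs.ne])
    rwa [hsum] at this

/-- Two worst cases differ by at most the largest deviation of the expectation of a truncation of
`V` at one of its own values. -/
lemma abs_worstCase_sub_le (hp : p ∈ stdSimplex ℝ (Fin S)) (hp' : p' ∈ stdSimplex ℝ (Fin S))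
    (hσ : 0 ≤ σ) {B : ℝ}
    (h : ∀ s₁, |(p' - p) ⬝ᵥ fun s => min (V s) (V s₁)| ≤ B) :
    |worstCase σ p V - worstCase σ p' V| ≤ B := by
  have hne : Nonempty (Fin S) := by
    by_contra hS
    rw [not_nonempty_iff] at hS
    simpa using hp.2
  obtain ⟨s₀, hs₀⟩ := Finite.exists_min V
  rw [abs_sub_le_iff]
  constructor
  · obtain ⟨s₁, h₁⟩ := exists_worstCase_le_dual hp hσ s₀ hs₀
    have h₂ := dual_le_worstCase hp' hσ hs₀ (hs₀ s₁)
    have h₃ := (abs_le.1 (h s₁)).1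
    rw [sub_dotProduct] at h₃
    linarith
  · obtain ⟨s₁, h₁⟩ := exists_worstCase_le_dual hp' hσ s₀ hs₀
    have h₂ := dual_le_worstCase hp hσ hs₀ (hs₀ s₁)
    have h₃ := (abs_le.1 (h s₁)).2
    rw [sub_dotProduct] at h₃
    linarith

lemma le_worstCase_of_forall_le (hp : p ∈ stdSimplex ℝ (Fin S)) (hσ : 0 ≤ σ)
    (hm : ∀ s, m ≤ V s) : m ≤ worstCase σ p V :=
  le_worstCase hp hσ fun _ hq => le_dotProduct_of_forall_le hq.1 hm

/-- The adversary can move the fraction `σ` of the mass to the minimiser of `V`. -/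
lemma worstCase_le_mix (hp : p ∈ stdSimplex ℝ (Fin S)) (hσ : 0 ≤ σ) (hσ1 : σ ≤ 1)
    (hM : ∀ s, V s ≤ M) (s₀ : Fin S) :
    worstCase σ p V ≤ (1 - σ) * M + σ * V s₀ := by
  set e : Fin S → ℝ := Pi.single s₀ 1 with he
  have hδ : e ∈ stdSimplex ℝ (Fin S) := single_mem_stdSimplex ℝ s₀
  have hmem : (1 - σ) • p + σ • e ∈ tvBall σ p := by
    refine ⟨(convex_stdSimplex ℝ (Fin S)) hp hδ (by linarith) hσ (by ring), ?_⟩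
    have : ∑ s, |((1 - σ) • p + σ • e) s - p s|
        ≤ ∑ s, σ * (p s + e s) := by
      refine Finset.sum_le_sum fun s _ => ?_
      have h1 := hp.1 s
      have h2 := hδ.1 s
      have : ((1 - σ) • p + σ • e) s - p s
          = σ * (e s - p s) := by
        simp only [Pi.add_apply, Pi.smul_apply, smul_eq_mul]; ring
      rw [this, abs_mul, abs_of_nonneg hσ]
      refine mul_le_mul_of_nonneg_left ?_ hσ
      rw [abs_le]
      constructor <;> linarith
    rw [← Finset.mul_sum, Finset.sum_add_distrib, hp.2, hδ.2] at this
    linarith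
  refine (worstCase_le hp hσ hmem).trans ?_
  rw [add_dotProduct, smul_dotProduct, smul_dotProduct, he, single_dotProduct, one_mul]
  have := mul_le_mul_of_nonneg_left (dotProduct_le_of_forall_le hp hM) (sub_nonneg.2 hσ1)
  simp only [smul_eq_mul]
  linarith

end WorstCase
end RobustMarkovGame

/-! ### Values under a fixed kernel -/

section Chain

variable {X : Type*} {m : ℕ}

/-- Probability of the path `τ` of an inhomogeneous chain with initial weights `w`, whose
transition from the `j`-th to the next point of the path is given by `K (t + j)`. -/
def chainWeight (w : X → ℝ) (K : ℕ → X → X → ℝ) (t : ℕ) (τ : Fin m → X) : ℝ :=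
  ∏ j : Fin m, if j.val = 0 then w (τ j) else
    K (t + (j.val - 1)) (τ ⟨j.val - 1, lt_of_le_of_lt (Nat.sub_le _ _) j.isLt⟩) (τ j)

lemma chainWeight_cons (w : X → ℝ) (K : ℕ → X → X → ℝ) (t : ℕ) (x : X) (τ : Fin m → X) :
    chainWeight w K t (Fin.cons x τ : Fin (m + 1) → X) = w x * chainWeight (K t x) K (t + 1) τ := by
  unfold chainWeight
  rw [Fin.prod_univ_succ]
  congr 1
  refine Finset.prod_congr rfl fun j _ => ?_
  obtain ⟨j, hj⟩ := j
  cases j with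
  | zero => rfl
  | succ j =>
    have h : t + (j + 1) = t + 1 + j := by ring
    simp only [Fin.val_succ, Nat.add_sub_cancel, if_neg (Nat.succ_ne_zero _), h]
    rfl

variable [Fintype X]

/-- Expected total reward over `m` steps of the chain with kernels `K` started in `x` at time `t`,
by backward recursion. -/
def chainValue (K : ℕ → X → X → ℝ) (ρ : ℕ → X → ℝ) : ℕ → ℕ → X → ℝ
  | 0, _, _ => 0
  | m + 1, t, x => ρ t x + ∑ x', K t x x' * chainValue K ρ m (t + 1) x'

lemma sum_cons (F : (Fin (m + 1) → X) → ℝ) :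
    ∑ τ, F τ = ∑ x, ∑ τ : Fin m → X, F (Fin.cons x τ) := by
  rw [← (Fin.consEquiv fun _ => X).sum_comp, Fintype.sum_prod_type]
  rfl

lemma sum_chainWeight {K : ℕ → X → X → ℝ} (hK : ∀ t x, ∑ x', K t x x' = 1) (t : ℕ)
    {w : X → ℝ} (hw : ∑ x, w x = 1) : ∑ τ : Fin m → X, chainWeight w K t τ = 1 := by
  induction m generalizing t w with
  | zero => simp [chainWeight]
  | succ m ih =>
    rw [sum_cons]
    simp only [chainWeight_cons, ← Finset.mul_sum, ih (t + 1) (hK t _), mul_one, hw]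

lemma sum_chainWeight_mul {K : ℕ → X → X → ℝ} (hK : ∀ t x, ∑ x', K t x x' = 1)
    (ρ : ℕ → X → ℝ) (t : ℕ) {w : X → ℝ} (hw : ∑ x, w x = 1) :
    ∑ τ : Fin m → X, chainWeight w K t τ * ∑ j : Fin m, ρ (t + j) (τ j)
      = ∑ x, w x * chainValue K ρ m t x := by
  induction m generalizing t w with
  | zero => simp [chainValue]
  | succ m ih =>
    rw [sum_cons]
    refine Finset.sum_congr rfl fun x _ => ?_
    have h1 : ∀ τ : Fin m → X, chainWeight w K t (Fin.cons x τ : Fin (m + 1) → X)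
        * ∑ j : Fin (m + 1), ρ (t + j) ((Fin.cons x τ : Fin (m + 1) → X) j)
        = w x * (chainWeight (K t x) K (t + 1) τ * ρ t x
          + chainWeight (K t x) K (t + 1) τ * ∑ j : Fin m, ρ (t + 1 + j) (τ j)) := fun τ => by
      rw [chainWeight_cons, Fin.sum_univ_succ]
      have h2 : ∀ j : Fin m, t + (j.val + 1) = t + 1 + j.val := fun j => by ring
      simp only [Fin.cons_zero, Fin.cons_succ, Fin.val_zero, Fin.val_succ, add_zero, h2]
      ring
    simp only [h1, ← Finset.mul_sum, Finset.sum_add_distrib, ← Finset.sum_mul]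
    rw [sum_chainWeight hK (t + 1) (hK t x), ih (t + 1) (hK t x), one_mul, chainValue]

end Chain

namespace RobustMarkovGame

variable {n H S : ℕ} {A : Fin n → ℕ}

/-- Value of agent `i` from step `h` on under the policy `π` and the fixed kernel `P`, by the
backward Bellman recursion. -/
noncomputable def policyValue (G : RobustMarkovGame n H S A) (π : JointPolicy H S A)
    (P : TransitionArray H S A) (i : Fin n) (h : ℕ) : Fin S → ℝ :=
  if hh : h < H then fun s => JointDist.expect (π ⟨h, hh⟩ s) fun a =>
    G.reward i ⟨h, hh⟩ s a + P ⟨h, hh⟩ s a ⬝ᵥ policyValue G π P i (h + 1)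
  else fun _ => 0
termination_by H - h

lemma policyValue_of_lt (G : RobustMarkovGame n H S A) (π : JointPolicy H S A)
    (P : TransitionArray H S A) (i : Fin n) {h : ℕ} (hh : h < H) (s : Fin S) :
    G.policyValue π P i h s = JointDist.expect (π ⟨h, hh⟩ s) fun a =>
      G.reward i ⟨h, hh⟩ s a + P ⟨h, hh⟩ s a ⬝ᵥ G.policyValue π P i (h + 1) := by
  rw [policyValue, dif_pos hh]

lemma policyValue_of_le (G : RobustMarkovGame n H S A) (π : JointPolicy H S A)
    (P : TransitionArray H S A) (i : Fin n) {h : ℕ} (hh : H ≤ h) :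
    G.policyValue π P i h = fun _ => 0 := by
  rw [policyValue, dif_neg hh.not_gt]

lemma value_eq_policyValue (G : RobustMarkovGame n H S A) (π : JointPolicy H S A)
    {P : TransitionArray H S A} (hP : ∀ h s a, P h s a ∈ stdSimplex ℝ (Fin S)) (i : Fin n)
    (hH : 0 < H) (s : Fin S) : G.value π P i s = G.policyValue π P i 0 s := by
  -- Time is clamped to the horizon, so that the kernels are stochastic at all times.
  let c : ℕ → Fin H := fun t => ⟨min t (H - 1), by omega⟩
  have hc : ∀ t (ht : t < H), c t = ⟨t, ht⟩ := fun t ht => Fin.ext (by simp [c]; omega)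
  let K : ℕ → (Fin S × JointAction A) → (Fin S × JointAction A) → ℝ := fun t x x' =>
    P (c t) x.1 x.2 x'.1 * (π (c (t + 1)) x'.1).1 x'.2
  let ρ : ℕ → (Fin S × JointAction A) → ℝ := fun t x => G.reward i (c t) x.1 x.2
  let w : (Fin S × JointAction A) → ℝ := fun x => (if x.1 = s then 1 else 0) * (π (c 0) x.1).1 x.2
  have hK : ∀ t x, ∑ x', K t x x' = 1 := fun t x => by
    simp only [K, Fintype.sum_prod_type, ← Finset.mul_sum]
    simp only [fun s' => (π (c (t + 1)) s').2.2, mul_one, (hP (c t) x.1 x.2).2]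
  have hw : ∑ x, w x = 1 := by
    have h : ∀ s', ∑ a, (if s' = s then (1 : ℝ) else 0) * (π (c 0) s').1 a
        = if s' = s then 1 else 0 := fun s' => by rw [← Finset.mul_sum, (π (c 0) s').2.2, mul_one]
    simp only [w, Fintype.sum_prod_type, h]
    simp
  have hval : ∀ m t x, t + (m + 1) = H → chainValue K ρ (m + 1) t x
      = ρ t x + P (c t) x.1 x.2 ⬝ᵥ G.policyValue π P i (t + 1) := by
    intro m
    induction m with
    | zero =>
      intro t x ht
      rw [policyValue_of_le G π P i (by omega)]
      simp [chainValue, dotProduct]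
    | succ m ih =>
      intro t x ht
      rw [chainValue]
      congr 1
      simp only [ih (t + 1) _ (by omega), Fintype.sum_prod_type, dotProduct, K]
      refine Finset.sum_congr rfl fun s' _ => ?_
      rw [policyValue_of_lt G π P i (by omega : t + 1 < H), JointDist.expect, Finset.mul_sum,
        ← hc (t + 1) (by omega)]
      refine Finset.sum_congr rfl fun a _ => ?_
      simp only [ρ, dotProduct, mul_assoc]
  have h1 : G.value π P i s = ∑ τ : Fin H → (Fin S × JointAction A), chainWeight w K 0 τ
      * ∑ j : Fin H, ρ (0 + j) (τ j) := by
    unfold value trajProb chainWeight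
    refine Finset.sum_congr rfl fun τ _ => ?_
    congr 1
    · refine Finset.prod_congr rfl fun t _ => ?_
      by_cases ht : t.val = 0
      · have : c 0 = t := Fin.ext (by simp [c, ht])
        simp only [ht, if_true, w, this]
      · have h2 : c (0 + (t.val - 1)) = ⟨t.val - 1, lt_of_le_of_lt (Nat.sub_le _ _) t.isLt⟩ := by
          rw [zero_add]; exact hc _ _
        have h3 : c (0 + (t.val - 1) + 1) = t := by
          rw [zero_add, Nat.sub_add_cancel (Nat.pos_of_ne_zero ht)]; exact hc _ t.isLt
        simp only [ht, if_false, K, h2, h3]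
    · refine Finset.sum_congr rfl fun t _ => ?_
      have : c (0 + t.val) = t := by rw [zero_add]; exact hc _ t.isLt
      simp only [ρ, this]
  obtain ⟨m, rfl⟩ : ∃ m, H = m + 1 := ⟨H - 1, by omega⟩
  rw [h1, sum_chainWeight_mul hK ρ 0 hw, policyValue_of_lt G π P i hH, JointDist.expect]
  simp only [hval m 0 _ (by omega), Fintype.sum_prod_type, w, hc 0 hH, ρ, ite_mul, one_mul,
    zero_mul]
  rw [Finset.sum_comm]
  simp

end RobustMarkovGame

/-! ### Accumulation of one-step errors -/

namespace JointDist

variable {n : ℕ} {A : Fin n → ℕ} {μ : stdSimplex ℝ (JointAction A)} {f g : JointAction A → ℝ}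

lemma expect_mono (h : ∀ a, f a ≤ g a) : expect μ f ≤ expect μ g :=
  Finset.sum_le_sum fun a _ => mul_le_mul_of_nonneg_left (h a) (μ.2.1 a)

lemma expect_const (c : ℝ) : expect μ (fun _ => c) = c := by
  rw [expect, ← Finset.sum_mul, μ.2.2, one_mul]

lemma expect_add : expect μ (fun a => f a + g a) = expect μ f + expect μ g := by
  simp only [expect, mul_add, Finset.sum_add_distrib]

lemma expect_sub : expect μ (fun a => f a - g a) = expect μ f - expect μ g := by
  simp only [expect, mul_sub, Finset.sum_sub_distrib]

lemma expect_const_mul (c : ℝ) : expect μ (fun a => c * f a) = c * expect μ f := by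
  simp only [expect, Finset.mul_sum]
  exact Finset.sum_congr rfl fun a _ => by ring

lemma expect_nonneg (h : ∀ a, 0 ≤ f a) : 0 ≤ expect μ f :=
  Finset.sum_nonneg fun a _ => mul_nonneg (μ.2.1 a) (h a)

lemma sq_expect_le : expect μ f ^ 2 ≤ expect μ fun a => f a ^ 2 := by
  have h : 0 ≤ expect μ fun a => (f a - expect μ f) ^ 2 := expect_nonneg fun a => sq_nonneg _
  have h2 : ∀ a, (f a - expect μ f) ^ 2
      = f a ^ 2 - (2 * expect μ f) * f a + expect μ f ^ 2 := fun a => by ring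
  simp only [h2, expect_add, expect_sub, expect_const_mul, expect_const] at h
  nlinarith

end JointDist

open JointDist

variable {n S : ℕ} {A : Fin n → ℕ}

/-- One backward step of the potential argument. By Jensen's inequality the mean of
`(q · W') ^ 2` is at least `(E[q · W']) ^ 2`, so the subsolution property of `W` bounds it below by
`W ^ 2` up to terms linear in `M`. -/
lemma potential_step {lam M κ κ₀ : ℝ} (hlam : 0 ≤ lam) (hM : 4 * lam * M ≤ 1)
    (μ : stdSimplex ℝ (JointAction A)) {q : JointAction A → Fin S → ℝ}
    (hq : ∀ a, q a ∈ stdSimplex ℝ (Fin S)) {b : JointAction A → ℝ} (hb : ∀ a, 0 ≤ b a)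
    {W' D' : Fin S → ℝ} {W D : ℝ} (hW0 : 0 ≤ W) (hWM : W ≤ M) (hW'0 : ∀ s, 0 ≤ W' s)
    (hW : W ≤ expect μ fun a => q a ⬝ᵥ W' + 1 + b a)
    (hD : D ≤ expect μ fun a => b a + q a ⬝ᵥ D')
    (hbvar : ∀ a, b a ≤ lam * (finVar (q a) W' + M) + κ₀)
    (hD' : ∀ s, D' s ≤ κ - 2 * lam * W' s ^ 2) :
    D ≤ (6 * lam * M + 2 * κ₀) + κ - 2 * lam * W ^ 2 := by
  set B := expect μ b with hB
  set Y := expect μ fun a => q a ⬝ᵥ W' with hY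
  set U := expect μ fun a => finVar (q a) W' with hU
  have hB0 : 0 ≤ B := expect_nonneg hb
  have hY0 : 0 ≤ Y := expect_nonneg fun a => le_dotProduct_of_forall_le (hq a) hW'0
  have hU0 : 0 ≤ U := expect_nonneg fun a => finVar_nonneg (hq a)
  have hWY : W ≤ Y + 1 + B := by
    simpa only [expect_add, expect_const] using hW
  have hBU : B ≤ lam * (U + M) + κ₀ := by
    simpa only [expect_add, expect_const, expect_const_mul] using expect_mono (μ := μ) hbvar
  have hD2 : D ≤ B + (κ - 2 * lam * (U + expect μ fun a => (q a ⬝ᵥ W') ^ 2)) := by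
    have h1 : ∀ a, b a + q a ⬝ᵥ D'
        ≤ b a + (κ - 2 * lam * (finVar (q a) W' + (q a ⬝ᵥ W') ^ 2)) := fun a => by
      have h2 := dotProduct_mono (hq a) hD'
      rw [dotProduct_const_sub (hq a)] at h2
      have h3 : (q a ⬝ᵥ fun s => 2 * lam * W' s ^ 2)
          = 2 * lam * (finVar (q a) W' + (q a ⬝ᵥ W') ^ 2) := by
        rw [← sum_mul_sq (hq a)]
        exact dotProduct_smul (2 * lam) (q a) _
      linarith
    have h4 := hD.trans (expect_mono (μ := μ) h1)
    simpa only [expect_add, expect_sub, expect_const, expect_const_mul] using h4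
  have hJ : Y ^ 2 ≤ expect μ fun a => (q a ⬝ᵥ W') ^ 2 := sq_expect_le
  have hYW : W ^ 2 - 2 * M * (1 + B) ≤ Y ^ 2 := by
    have h5 : W * (1 + B) ≤ M * (1 + B) := mul_le_mul_of_nonneg_right hWM (by linarith)
    rcases le_total W (1 + B) with h | h
    · nlinarith [sq_nonneg Y, mul_nonneg hW0 (by linarith : 0 ≤ 1 + B)]
    · nlinarith [sq_nonneg (1 + B)]
  have h6 : 2 * lam * (W ^ 2 - 2 * M * (1 + B))
      ≤ 2 * lam * expect μ fun a => (q a ⬝ᵥ W') ^ 2 :=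
    mul_le_mul_of_nonneg_left (hYW.trans hJ) (by linarith)
  have h7 : 4 * lam * M * B ≤ 1 * B := mul_le_mul_of_nonneg_right hM hB0
  nlinarith

/-- The one-step errors `b` accumulate to at most `6 λ M + 2 κ₀` per step. The variances in the
bound on `b` are paid for by the drift of the potential `2 λ W ^ 2`. -/
lemma le_of_potential {H : ℕ} {lam M κ₀ : ℝ} (hlam : 0 ≤ lam) (hM : 4 * lam * M ≤ 1)
    (π : JointPolicy H S A) {q : TransitionArray H S A}
    (hq : ∀ h s a, q h s a ∈ stdSimplex ℝ (Fin S)) {b : Fin H → Fin S → JointAction A → ℝ}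
    (hb : ∀ h s a, 0 ≤ b h s a) {W D : ℕ → Fin S → ℝ} (hW0 : ∀ h s, 0 ≤ W h s)
    (hWM : ∀ h s, W h s ≤ M) (hWH : ∀ s, W H s = 0) (hDH : ∀ s, D H s ≤ 0)
    (hW : ∀ (h : Fin H) s, W h s ≤ expect (π h s) fun a => q h s a ⬝ᵥ W (h + 1) + 1 + b h s a)
    (hD : ∀ (h : Fin H) s, D h s ≤ expect (π h s) fun a => b h s a + q h s a ⬝ᵥ D (h + 1))
    (hbvar : ∀ h s a, b h s a ≤ lam * (finVar (q h s a) (W (h + 1)) + M) + κ₀) (s : Fin S) :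
    D 0 s ≤ H * (6 * lam * M + 2 * κ₀) := by
  have key : ∀ k h, h + k = H → ∀ s,
      D h s ≤ k * (6 * lam * M + 2 * κ₀) - 2 * lam * W h s ^ 2 := by
    intro k
    induction k with
    | zero =>
      rintro h rfl s
      have h1 := hDH s
      have h2 := hWH s
      simp only [add_zero] at h1 h2
      simp [h1, h2]
    | succ k ih =>
      intro h hh s
      have := potential_step hlam hM (π ⟨h, by omega⟩ s) (hq ⟨h, by omega⟩ s)
        (hb ⟨h, by omega⟩ s) (hW0 h s) (hWM h s) (hW0 (h + 1)) (hW ⟨h, by omega⟩ s)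
        (hD ⟨h, by omega⟩ s) (hbvar ⟨h, by omega⟩ s) (ih (h + 1) (by omega))
      push_cast
      linarith
  have := key H 0 (by omega) s
  nlinarith [mul_nonneg hlam (sq_nonneg (W 0 s))]

/-! ### Concentration of empirical transitions -/

section Chernoff

variable {Ω : Type*} [MeasurableSpace Ω] {μ : Measure Ω} [IsProbabilityMeasure μ] {N S : ℕ}

lemma sum_mul_exp_le {p f : Fin S → ℝ} (hp : p ∈ stdSimplex ℝ (Fin S)) {t a b : ℝ} (ht : 0 ≤ t)
    (ha : ∀ s, a ≤ f s) (hb : ∀ s, f s ≤ b) (htab : t * (b - a) ≤ 1) :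
    ∑ s, p s * Real.exp (t * (f s - p ⬝ᵥ f)) ≤ Real.exp (t ^ 2 * finVar p f) := by
  have hpa := le_dotProduct_of_forall_le hp ha
  have hpb := dotProduct_le_of_forall_le hp hb
  have h1 : ∀ s, Real.exp (t * (f s - p ⬝ᵥ f))
      ≤ 1 + t * (f s - p ⬝ᵥ f) + t ^ 2 * (f s - p ⬝ᵥ f) ^ 2 := fun s => by
    have h2 : |t * (f s - p ⬝ᵥ f)| ≤ 1 := by
      rw [abs_mul, abs_of_nonneg ht]
      refine (mul_le_mul_of_nonneg_left ?_ ht).trans htab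
      rw [abs_le]
      constructor <;> linarith [ha s, hb s]
    have h3 := (abs_le.1 (Real.abs_exp_sub_one_sub_id_le h2)).2
    rw [mul_pow] at h3
    linarith
  have h4 : ∑ s, p s * (f s - p ⬝ᵥ f) = 0 := by
    have := dotProduct_sub_const (f := f) (c := p ⬝ᵥ f) hp
    rw [sub_self] at this
    exact this
  calc ∑ s, p s * Real.exp (t * (f s - p ⬝ᵥ f))
      ≤ ∑ s, p s * (1 + t * (f s - p ⬝ᵥ f) + t ^ 2 * (f s - p ⬝ᵥ f) ^ 2) :=
        Finset.sum_le_sum fun s _ => mul_le_mul_of_nonneg_left (h1 s) (hp.1 s)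
    _ = ∑ s, p s + t * ∑ s, p s * (f s - p ⬝ᵥ f) + t ^ 2 * finVar p f := by
        simp only [finVar, Finset.mul_sum, ← Finset.sum_add_distrib]
        exact Finset.sum_congr rfl fun s _ => by ring
    _ = t ^ 2 * finVar p f + 1 := by rw [hp.2, h4]; ring
    _ ≤ _ := Real.add_one_le_exp _

/-- Chernoff bound for an empirical mean. For a fixed exponent `t` it reads as a linearised
Bernstein inequality. -/
lemma measureReal_empiricalMean_le {p f : Fin S → ℝ} (hp : p ∈ stdSimplex ℝ (Fin S))
    {t a b τ : ℝ} (ht : 0 < t) (ha : ∀ s, a ≤ f s) (hb : ∀ s, f s ≤ b) (htab : t * (b - a) ≤ 1)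
    (hN : 0 < N) {Y : Fin N → Ω → Fin S} (hY : ∀ k, Measurable (Y k)) (hind : iIndepFun Y μ)
    (hlaw : ∀ k s, μ.real {ω | Y k ω = s} = p s) :
    μ.real {ω | t * finVar p f + τ / (N * t) ≤ (1 / (N : ℝ)) * ∑ k, f (Y k ω) - p ⬝ᵥ f}
      ≤ Real.exp (-τ) := by
  have hN' : (0 : ℝ) < N := by exact_mod_cast hN
  set g : Fin S → ℝ := fun s => f s - p ⬝ᵥ f with hg
  set Z : Fin N → Ω → ℝ := fun k ω => g (Y k ω) with hZ
  have hgm : Measurable g := measurable_of_countable g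
  have hZm : ∀ k, Measurable (Z k) := fun k => hgm.comp (hY k)
  have hZind : iIndepFun Z μ := hind.comp (fun _ => g) fun _ => hgm
  have hmgf : ∀ k, mgf (Z k) μ t ≤ Real.exp (t ^ 2 * finVar p f) := fun k => by
    refine le_trans (le_of_eq ?_) (sum_mul_exp_le hp ht.le ha hb htab)
    have h1 : mgf (Z k) μ t = ∫ s, Real.exp (t * g s) ∂(μ.map (Y k)) := by
      rw [integral_map (hY k).aemeasurable (measurable_of_countable _).aestronglyMeasurable]
      rfl
    have : IsProbabilityMeasure (μ.map (Y k)) := Measure.isProbabilityMeasure_map (hY k).aemeasurable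
    rw [h1, integral_fintype (Integrable.of_finite)]
    refine Finset.sum_congr rfl fun s _ => ?_
    rw [map_measureReal_apply (hY k) (measurableSet_singleton s), smul_eq_mul]
    congr 1
    exact hlaw k s
  have hsum : ∀ ω, (∑ k, Z k) ω = N * ((1 / (N : ℝ)) * ∑ k, f (Y k ω) - p ⬝ᵥ f) := fun ω => by
    simp only [Finset.sum_apply, hZ, hg, Finset.sum_sub_distrib, Finset.sum_const,
      Finset.card_univ, Fintype.card_fin, nsmul_eq_mul]
    field_simp
  have hint : Integrable (fun ω => Real.exp (t * (∑ k, Z k) ω)) μ := by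
    have h2 : (fun ω => Real.exp (t * (∑ k, Z k) ω))
        = (fun y : Fin N → Fin S => Real.exp (t * ∑ k, g (y k))) ∘ fun ω k => Y k ω := by
      ext ω
      simp [hZ]
    rw [h2]
    refine Integrable.comp_measurable ?_ (measurable_pi_lambda _ hY)
    have : IsProbabilityMeasure (μ.map fun ω k => Y k ω) :=
      Measure.isProbabilityMeasure_map (measurable_pi_lambda _ hY).aemeasurable
    exact Integrable.of_finite
  have hsub : {ω | t * finVar p f + τ / (N * t) ≤ (1 / (N : ℝ)) * ∑ k, f (Y k ω) - p ⬝ᵥ f}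
      ⊆ {ω | N * (t * finVar p f + τ / (N * t)) ≤ (∑ k, Z k) ω} := fun ω hω => by
    rw [Set.mem_ofPred_eq, hsum]
    exact mul_le_mul_of_nonneg_left hω hN'.le
  refine (measureReal_mono hsub).trans ((measure_ge_le_exp_mul_mgf _ ht.le hint).trans ?_)
  rw [hZind.mgf_sum hZm]
  have h3 : ∏ k, mgf (Z k) μ t ≤ Real.exp (N * (t ^ 2 * finVar p f)) := by
    refine (Finset.prod_le_prod (fun k _ => mgf_nonneg) fun k _ => hmgf k).trans (le_of_eq ?_)
    rw [Finset.prod_const, Finset.card_univ, Fintype.card_fin, ← Real.exp_nat_mul]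
  refine (mul_le_mul_of_nonneg_left h3 (Real.exp_pos _).le).trans (le_of_eq ?_)
  rw [← Real.exp_add]
  congr 1
  field_simp
  ring

/-- A probability bound that holds for each fixed value of `Z` holds for `Z` random and
independent of `Y`. -/
lemma measureReal_le_of_indepFun {α β : Type*} [MeasurableSpace α] [MeasurableSpace β]
    [Finite α] [Fintype β] [MeasurableSingletonClass α] [MeasurableSingletonClass β]
    {Y : Ω → α} {Z : Ω → β} (hZ : Measurable Z) (h : IndepFun Y Z μ) (B : β → Set α) {c : ℝ}
    (hB : ∀ z, μ.real (Y ⁻¹' B z) ≤ c) : μ.real {ω | Y ω ∈ B (Z ω)} ≤ c := by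
  have h1 : {ω | Y ω ∈ B (Z ω)} ⊆ ⋃ z, (Y ⁻¹' B z ∩ Z ⁻¹' {z}) := fun ω hω =>
    Set.mem_iUnion.2 ⟨Z ω, hω, rfl⟩
  have h2 : ∀ z, μ.real (Y ⁻¹' B z ∩ Z ⁻¹' {z}) ≤ c * μ.real (Z ⁻¹' {z}) := fun z => by
    rw [measureReal_def, h.measure_inter_preimage_eq_mul _ _ (Set.toFinite _).measurableSet
      (measurableSet_singleton z), ENNReal.toReal_mul]
    exact mul_le_mul_of_nonneg_right (hB z) ENNReal.toReal_nonneg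
  refine (measureReal_mono h1).trans ((measureReal_iUnion_fintype_le _).trans
    ((Finset.sum_le_sum fun z _ => h2 z).trans (le_of_eq ?_)))
  rw [← Finset.mul_sum, sum_measureReal_preimage_singleton _ fun z _ =>
    hZ (measurableSet_singleton z)]
  simp

end Chernoff

namespace RobustMarkovGame

variable {n H S N : ℕ} {A : Fin n → ℕ}

lemma empirical_dotProduct (D : Dataset N H S A) (h : Fin H) (s : Fin S) (a : JointAction A)
    (f : Fin S → ℝ) : empirical D h s a ⬝ᵥ f = (1 / (N : ℝ)) * ∑ k, f (D k h s a) := by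
  simp only [empirical, dotProduct, mul_assoc, Finset.sum_mul, ← Finset.mul_sum]
  rw [Finset.sum_comm]
  simp

lemma empirical_mem (hN : 0 < N) (D : Dataset N H S A) (h : Fin H) (s : Fin S)
    (a : JointAction A) : empirical D h s a ∈ stdSimplex ℝ (Fin S) := by
  have hN' : (0 : ℝ) < N := by exact_mod_cast hN
  refine ⟨fun s' => mul_nonneg (by positivity) (Finset.sum_nonneg fun k _ => ?_), ?_⟩
  · split_ifs <;> norm_num
  · have := empirical_dotProduct D h s a fun _ => 1
    simp only [dotProduct, mul_one, Finset.sum_const, Finset.card_univ, Fintype.card_fin,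
      nsmul_eq_mul] at this
    rw [this]
    field_simp

lemma nviV_of_lt (G : RobustMarkovGame n H S A) (P : TransitionArray H S A)
    (E : EquilibriumRoutine A) {h : ℕ} (hh : h < H) (i : Fin n) (s : Fin S) :
    G.nviV P E h i s = JointDist.expect (E (G.nviQ P E ⟨h, hh⟩ s)) (G.nviQ P E ⟨h, hh⟩ s i) := by
  rw [nviV, dif_pos hh]
  rfl

lemma nviV_of_le (G : RobustMarkovGame n H S A) (P : TransitionArray H S A)
    (E : EquilibriumRoutine A) {h : ℕ} (hh : H ≤ h) : G.nviV P E h = fun _ _ => 0 := by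
  rw [nviV, dif_neg hh.not_gt]

/-- The value estimates at step `h` use the transitions from step `h` on only. -/
lemma nviV_congr (G : RobustMarkovGame n H S A) {P P' : TransitionArray H S A}
    (E : EquilibriumRoutine A) {h : ℕ} (hP : ∀ h' : Fin H, h ≤ h' → P h' = P' h') :
    G.nviV P E h = G.nviV P' E h := by
  by_cases hh : h < H
  · have ih := nviV_congr G E (h := h + 1) fun h' hh' => hP h' (by omega)
    ext i s
    rw [nviV_of_lt G P E hh, nviV_of_lt G P' E hh]
    have : G.nviQ P E ⟨h, hh⟩ s = G.nviQ P' E ⟨h, hh⟩ s := by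
      unfold nviQ nviQStep
      rw [ih, hP ⟨h, hh⟩ le_rfl]
    rw [this]
  · rw [nviV_of_le G P E (not_lt.1 hh), nviV_of_le G P' E (not_lt.1 hh)]
termination_by H - h

/-- Concentration of the empirical transitions at step `h` against a function of the samples at
the other steps. -/
lemma measureReal_empirical_le {Ω : Type*} [MeasurableSpace Ω] {μ : Measure Ω}
    [IsProbabilityMeasure μ] {G : RobustMarkovGame n H S A} {X : Ω → Dataset N H S A}
    (hX : G.IsGenerativeSample μ X) (hN : 0 < N) (hS : 0 < S) (h : Fin H) (s : Fin S)
    (a : JointAction A) (F : Dataset N H S A → Fin S → ℝ)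
    (hF : ∀ D D' : Dataset N H S A, (∀ k h', h' ≠ h → D k h' = D' k h') → F D = F D')
    {lo hi : Dataset N H S A → ℝ} (hlo : ∀ D s', lo D ≤ F D s') (hhi : ∀ D s', F D s' ≤ hi D)
    {t τ : ℝ} (ht : 0 < t) (hspan : ∀ D, t * (hi D - lo D) ≤ 1) :
    μ.real {ω | t * finVar (G.nominal h s a) (F (X ω)) + τ / (N * t)
        ≤ (empirical (X ω) h s a - G.nominal h s a) ⬝ᵥ F (X ω)} ≤ Real.exp (-τ) := by
  classical
  let ξ : (Fin N × Fin H × Fin S × JointAction A) → Ω → Fin S := fun x ω =>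
    X ω x.1 x.2.1 x.2.2.1 x.2.2.2
  let I : Finset (Fin N × Fin H × Fin S × JointAction A) := {x | x.2 = (h, s, a)}
  let J : Finset (Fin N × Fin H × Fin S × JointAction A) := {x | x.2.1 ≠ h}
  have hIJ : Disjoint I J := by
    rw [Finset.disjoint_left]
    intro x hx hx'
    simp only [I, J, Finset.mem_filter, Finset.mem_univ, true_and] at hx hx'
    exact hx' (by rw [hx])
  have hξ : ∀ x, Measurable (ξ x) := fun x => hX.measurable _ _ _ _
  have hind := hX.indep.indepFun_finset I J hIJ hξ
  have hkI : ∀ k : Fin N, (k, h, s, a) ∈ I := fun k => by simp [I]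
  let D₀ : (J → Fin S) → Dataset N H S A := fun z k h' s' a' =>
    if hx : (k, h', s', a') ∈ J then z ⟨_, hx⟩ else ⟨0, hS⟩
  have hD₀ : ∀ ω, F (X ω) = F (D₀ fun x => ξ x ω) := fun ω => hF _ _ fun k h' hh' => by
    ext s' a'
    have hx : (k, h', s', a') ∈ J := by simpa [J] using hh'
    simp only [D₀, dif_pos hx]
    rfl
  let B : (J → Fin S) → Set (I → Fin S) := fun z =>
    {y | t * finVar (G.nominal h s a) (F (D₀ z)) + τ / (N * t)
      ≤ (1 / (N : ℝ)) * ∑ k, F (D₀ z) (y ⟨(k, h, s, a), hkI k⟩)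
        - G.nominal h s a ⬝ᵥ F (D₀ z)}
  have key := measureReal_le_of_indepFun (μ := μ) (Y := fun ω (x : I) => ξ x ω)
    (Z := fun ω (x : J) => ξ x ω) (measurable_pi_lambda _ fun x => hξ x) hind B
    (c := Real.exp (-τ)) fun z =>
      measureReal_empiricalMean_le (G.nominal_mem h s a) ht (hlo (D₀ z)) (hhi (D₀ z))
        (hspan (D₀ z)) hN (Y := fun k => ξ (k, h, s, a)) (fun k => hξ _)
        (hX.indep.precomp (g := fun k : Fin N => (k, h, s, a)) fun k k' hkk => by simpa using hkk)
        (fun k s' => hX.law k h s a s')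
  refine le_of_eq_of_le ?_ key
  congr 1
  ext ω
  simp only [Set.mem_ofPred_eq, B, sub_dotProduct, empirical_dotProduct, hD₀ ω]
  rfl

end RobustMarkovGame

/-! ### One-step errors and robust values of DR-NVI -/

namespace RobustMarkovGame

variable {n H S N : ℕ} {A : Fin n → ℕ}

section Span

variable (G : RobustMarkovGame n H S A) {P : TransitionArray H S A}
  (hP : ∀ h s a, P h s a ∈ stdSimplex ℝ (Fin S)) (E : EquilibriumRoutine A) (i : Fin n)
include hP

lemma nviV_le_of_forall_le {h : ℕ} (hh : h < H) {c : ℝ} (hc : ∀ s, G.nviV P E (h + 1) i s ≤ c)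
    (s : Fin S) : G.nviV P E h i s ≤ 1 + c := by
  rw [nviV_of_lt G P E hh, ← JointDist.expect_const (μ := E (G.nviQ P E ⟨h, hh⟩ s)) (1 + c)]
  refine JointDist.expect_mono fun a => add_le_add (G.reward_mem _ _ _ _).2 ?_
  exact (worstCase_le (hP _ _ _) (G.level_pos i).le
    (mem_tvBall_self (hP _ _ _) (G.level_pos i).le)).trans (dotProduct_le_of_forall_le (hP _ _ _) hc)

lemma le_nviV_of_forall_le {h : ℕ} (hh : h < H) {c : ℝ} (hc : ∀ s, c ≤ G.nviV P E (h + 1) i s)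
    (s : Fin S) : c ≤ G.nviV P E h i s := by
  rw [nviV_of_lt G P E hh, ← JointDist.expect_const (μ := E (G.nviQ P E ⟨h, hh⟩ s)) c]
  refine JointDist.expect_mono fun a => ?_
  have := le_worstCase_of_forall_le (hP ⟨h, hh⟩ s a) (G.level_pos i).le hc
  have := (G.reward_mem i ⟨h, hh⟩ s a).1
  change c ≤ G.reward i ⟨h, hh⟩ s a + worstCase (G.level i) (P ⟨h, hh⟩ s a) (G.nviV P E (h + 1) i)
  linarith

/-- One step backwards shrinks the oscillation by the factor `1 - σ`, up to the reward. -/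
lemma nviV_sub_le_step (hlevel : G.level i ≤ 1) {h : ℕ} (hh : h < H) {c : ℝ}
    (hc : ∀ s s', G.nviV P E (h + 1) i s - G.nviV P E (h + 1) i s' ≤ c) (s s' : Fin S) :
    G.nviV P E h i s - G.nviV P E h i s' ≤ 1 + (1 - G.level i) * c := by
  have : Nonempty (Fin S) := ⟨s⟩
  obtain ⟨s₀, hs₀⟩ := Finite.exists_min (G.nviV P E (h + 1) i)
  have h1 := le_nviV_of_forall_le G hP E i hh hs₀ s'
  have h2 : G.nviV P E h i s ≤ 1 + ((1 - G.level i) * c + G.nviV P E (h + 1) i s₀) := by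
    rw [nviV_of_lt G P E hh, ← JointDist.expect_const (μ := E (G.nviQ P E ⟨h, hh⟩ s)) (1 + _)]
    refine JointDist.expect_mono fun a => add_le_add (G.reward_mem _ _ _ _).2 ?_
    refine (worstCase_le_mix (M := c + G.nviV P E (h + 1) i s₀) (hP _ _ _) (G.level_pos i).le
      hlevel (fun s => ?_) s₀).trans (le_of_eq (by ring))
    linarith [hc s s₀]
  linarith

/-- The value estimates of agent `i` oscillate by at most `min {H, 1 / σᵢ}`. -/
lemma nviV_sub_le (hlevel : G.level i ≤ 1) (h : ℕ) (s s' : Fin S) :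
    G.nviV P E h i s - G.nviV P E h i s' ≤ min (H : ℝ) (1 / G.level i) := by
  have hσ := G.level_pos i
  have key : ∀ k h, h + k = H → ∀ s s', G.nviV P E h i s - G.nviV P E h i s' ≤ k ∧
      G.nviV P E h i s - G.nviV P E h i s' ≤ 1 / G.level i := by
    intro k
    induction k with
    | zero =>
      rintro h rfl s s'
      rw [nviV_of_le G P E (by omega)]
      simpa using hσ.le
    | succ k ih =>
      intro h hh s s'
      have h1 := nviV_sub_le_step G hP E i hlevel (by omega)
        (fun s s' => (ih (h + 1) (by omega) s s').1) s s'
      have h2 := nviV_sub_le_step G hP E i hlevel (by omega)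
        (fun s s' => (ih (h + 1) (by omega) s s').2) s s'
      constructor
      · push_cast
        nlinarith [(Nat.cast_nonneg k : (0 : ℝ) ≤ k)]
      · refine h2.trans (le_of_eq ?_)
        field_simp
        ring
  rcases le_total h H with hh | hh
  · obtain ⟨h1, h2⟩ := key (H - h) h (by omega) s s'
    refine le_min (h1.trans ?_) h2
    exact_mod_cast Nat.sub_le H h
  · rw [nviV_of_le G P E hh]
    simpa using hσ.le

end Span

/-- The event that all one-step errors of the data set obey a linearised Bernstein bound has high
probability. The union bound also runs over the truncation levels of the dual problem. -/
lemma le_measureReal_worstCase_error {Ω : Type*} [MeasurableSpace Ω] {μ : Measure Ω}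
    [IsProbabilityMeasure μ] {G : RobustMarkovGame n H S A} {X : Ω → Dataset N H S A}
    (hX : G.IsGenerativeSample μ X) (hN : 0 < N) (hS : 0 < S) (hlevel : ∀ i, G.level i ≤ 1)
    (E : EquilibriumRoutine A) {t τ : ℝ} (ht : 0 < t)
    (htM : ∀ i, t * min (H : ℝ) (1 / G.level i) ≤ 1) :
    1 - (n * H * S * (∏ i, (A i : ℝ)) * S) * (2 * Real.exp (-τ)) ≤
      μ.real {ω | ∀ i (h : Fin H) s a,
        |worstCase (G.level i) (G.nominal h s a) (G.nviV (empirical (X ω)) E (h + 1) i)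
          - worstCase (G.level i) (empirical (X ω) h s a) (G.nviV (empirical (X ω)) E (h + 1) i)|
        ≤ t * finVar (G.nominal h s a) (G.nviV (empirical (X ω)) E (h + 1) i) + τ / (N * t)} := by
  set good := {ω | ∀ i (h : Fin H) s a,
        |worstCase (G.level i) (G.nominal h s a) (G.nviV (empirical (X ω)) E (h + 1) i)
          - worstCase (G.level i) (empirical (X ω) h s a) (G.nviV (empirical (X ω)) E (h + 1) i)|
        ≤ t * finVar (G.nominal h s a) (G.nviV (empirical (X ω)) E (h + 1) i) + τ / (N * t)}
  let V : Fin n → Fin H → Dataset N H S A → Fin S → ℝ := fun i h D =>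
    G.nviV (empirical D) E (h + 1) i
  let F : Fin n → Fin H → Fin S → Dataset N H S A → Fin S → ℝ := fun i h s₁ D s' =>
    min (V i h D s') (V i h D s₁)
  have hF : ∀ i h s₁ (D D' : Dataset N H S A), (∀ k h', h' ≠ h → D k h' = D' k h') →
      F i h s₁ D = F i h s₁ D' := by
    intro i h s₁ D D' hD
    have : V i h D = V i h D' := by
      refine congrFun (nviV_congr G E fun h' hh' => ?_) i
      have hne : h' ≠ h := by rintro rfl; omega
      unfold empirical
      simp only [fun k => hD k h' hne]
    simp only [F, this]
  have hne : Nonempty (Fin S) := ⟨⟨0, hS⟩⟩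
  have hmin : ∀ i h D, ∃ s₀, ∀ s, V i h D s₀ ≤ V i h D s := fun i h D => Finite.exists_min _
  choose lo hlo using hmin
  have hFlo : ∀ i h s₁ D s', V i h D (lo i h D) ≤ F i h s₁ D s' := fun i h s₁ D s' =>
    le_min (hlo i h D s') (hlo i h D s₁)
  have hFhi : ∀ i h s₁ D s', F i h s₁ D s' ≤ V i h D s₁ := fun i h s₁ D s' => min_le_right _ _
  have hspan : ∀ i h s₁ D, t * (V i h D s₁ - V i h D (lo i h D)) ≤ 1 := fun i h s₁ D =>
    (mul_le_mul_of_nonneg_left (nviV_sub_le G (empirical_mem hN D) E i (hlevel i) (h + 1) _ _)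
      ht.le).trans (htM i)
  let bad : (Fin n × Fin H × Fin S × JointAction A × Fin S) → Set Ω := fun x =>
    {ω | t * finVar (G.nominal x.2.1 x.2.2.1 x.2.2.2.1) (F x.1 x.2.1 x.2.2.2.2 (X ω))
        + τ / (N * t) ≤ (empirical (X ω) x.2.1 x.2.2.1 x.2.2.2.1
          - G.nominal x.2.1 x.2.2.1 x.2.2.2.1) ⬝ᵥ F x.1 x.2.1 x.2.2.2.2 (X ω)}
    ∪ {ω | t * finVar (G.nominal x.2.1 x.2.2.1 x.2.2.2.1) (-F x.1 x.2.1 x.2.2.2.2 (X ω))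
        + τ / (N * t) ≤ (empirical (X ω) x.2.1 x.2.2.1 x.2.2.2.1
          - G.nominal x.2.1 x.2.2.1 x.2.2.2.1) ⬝ᵥ (-F x.1 x.2.1 x.2.2.2.2 (X ω))}
  have hbad : ∀ x, μ.real (bad x) ≤ 2 * Real.exp (-τ) := fun ⟨i, h, s, a, s₁⟩ => by
    refine (measureReal_union_le _ _).trans ?_
    have h1 := measureReal_empirical_le hX hN hS h s a (F i h s₁) (hF i h s₁)
      (hFlo i h s₁) (hFhi i h s₁) (τ := τ) ht (hspan i h s₁)
    have h2 := measureReal_empirical_le hX hN hS h s a (fun D => -F i h s₁ D)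
      (fun D D' hD => by rw [hF i h s₁ D D' hD])
      (fun D s' => neg_le_neg (hFhi i h s₁ D s')) (fun D s' => neg_le_neg (hFlo i h s₁ D s'))
      (τ := τ) ht (fun D => by have := hspan i h s₁ D; linarith)
    rw [two_mul]
    exact add_le_add h1 h2
  have hcover : Set.univ ⊆ good ∪ ⋃ x, bad x := by
    intro ω _
    by_contra hω
    rw [Set.mem_union, not_or, Set.mem_iUnion, not_exists] at hω
    refine hω.1 fun i h s a => ?_
    refine abs_worstCase_sub_le (G.nominal_mem h s a) (empirical_mem hN (X ω) h s a)
      (G.level_pos i).le fun s₁ => ?_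
    have h1 := hω.2 (i, h, s, a, s₁)
    simp only [bad, Set.mem_union, Set.mem_ofPred_eq, not_or, not_le, finVar_neg,
      dotProduct_neg] at h1
    have h2 : finVar (G.nominal h s a) (F i h s₁ (X ω))
        ≤ finVar (G.nominal h s a) (V i h (X ω)) := finVar_min_le (G.nominal_mem h s a) _
    have h3 := mul_le_mul_of_nonneg_left h2 ht.le
    change |(empirical (X ω) h s a - G.nominal h s a) ⬝ᵥ F i h s₁ (X ω)|
      ≤ t * finVar (G.nominal h s a) (V i h (X ω)) + τ / (N * t)
    rw [abs_le]
    constructor <;> linarith [h1.1, h1.2]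
  have h1 : (1 : ℝ) ≤ μ.real good + ∑ x, μ.real (bad x) := by
    rw [← probReal_univ (μ := μ)]
    exact (measureReal_mono hcover).trans ((measureReal_union_le _ _).trans
      (add_le_add le_rfl (measureReal_iUnion_fintype_le _)))
  have h2 : ∑ x, μ.real (bad x)
      ≤ (n * H * S * (∏ i, (A i : ℝ)) * S) * (2 * Real.exp (-τ)) := by
    refine (Finset.sum_le_sum fun x _ => hbad x).trans (le_of_eq ?_)
    rw [Finset.sum_const, nsmul_eq_mul, Finset.card_univ]
    simp only [Fintype.card_prod, Fintype.card_pi, Fintype.card_fin]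
    push_cast
    ring
  linarith

section Deterministic

variable {G : RobustMarkovGame n H S A} {P : TransitionArray H S A}
  (hP : ∀ h s a, P h s a ∈ stdSimplex ℝ (Fin S)) {E : EquilibriumRoutine A} {i : Fin n}
  {lam M κ₀ : ℝ} (hlam : 0 ≤ lam) (hM : 4 * lam * M ≤ 1)
  (hspan : ∀ h s s', G.nviV P E h i s - G.nviV P E h i s' ≤ M) (hσM : G.level i * M ^ 2 ≤ M)
  (herr : ∀ (h : Fin H) s a,
    |worstCase (G.level i) (G.nominal h s a) (G.nviV P E (h + 1) i)
      - worstCase (G.level i) (P h s a) (G.nviV P E (h + 1) i)|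
      ≤ lam * finVar (G.nominal h s a) (G.nviV P E (h + 1) i) + κ₀)

lemma value_nonneg (G : RobustMarkovGame n H S A) (π : JointPolicy H S A)
    {Q : TransitionArray H S A} (hQ : ∀ h s a, Q h s a ∈ stdSimplex ℝ (Fin S)) (i : Fin n)
    (s : Fin S) : 0 ≤ G.value π Q i s := by
  refine Finset.sum_nonneg fun τ _ => mul_nonneg (Finset.prod_nonneg fun t _ => mul_nonneg ?_ ?_)
    (Finset.sum_nonneg fun t _ => (G.reward_mem _ _ _ _).1)
  · split_ifs
    exacts [zero_le_one, le_rfl, (hQ _ _ _).1 _]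
  · exact (π t (τ t).1).2.1 _

lemma robustValue_le_value (G : RobustMarkovGame n H S A) (π : JointPolicy H S A)
    {Q : TransitionArray H S A} (hQ : Q ∈ G.uncertaintySet i) (s : Fin S) :
    G.robustValue π i s ≤ G.value π Q i s :=
  ciInf_le ⟨0, by rintro _ ⟨Q', rfl⟩; exact value_nonneg G π (fun h s a => (Q'.2 h s a).1) i s⟩
    (⟨Q, hQ⟩ : G.uncertaintySet i)

include hspan hσM herr hlam in
lemma worstCase_error_le {h : Fin H} {s : Fin S} {a : JointAction A} {q : Fin S → ℝ}
    (hq : q ∈ tvBall (G.level i) (G.nominal h s a)) :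
    |worstCase (G.level i) (G.nominal h s a) (G.nviV P E (h + 1) i)
      - worstCase (G.level i) (P h s a) (G.nviV P E (h + 1) i)|
      ≤ lam * (finVar q (G.nviV P E (h + 1) i) + M) + κ₀ := by
  have : Nonempty (Fin S) := ⟨s⟩
  obtain ⟨s₀, hs₀⟩ := Finite.exists_min (G.nviV P E (h + 1) i)
  have h1 := finVar_le_of_tv (b := G.nviV P E (h + 1) i s₀ + M) (G.nominal_mem h s a) hq.1 hq.2
    hs₀ (fun s' => by linarith [hspan (h + 1) s' s₀])
  rw [add_sub_cancel_left] at h1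
  have h2 := mul_le_mul_of_nonneg_left (h1.trans (add_le_add le_rfl hσM)) hlam
  linarith [herr h s a]

include hP hlam hM hspan hσM herr

/-- The true robust value of a policy that is no better than the computed equilibrium for the
estimated payoffs is at most the estimated value plus the accumulated error. The adversary plays
the kernel which is worst for the estimated values, and the potential measures the distance of
the estimated value from its maximum. -/
lemma robustValue_le_nviV (hH : 0 < H) (π : JointPolicy H S A)
    (hπ : ∀ (h : Fin H) s, JointDist.expect (π h s) (G.nviQ P E h s i) ≤ G.nviV P E h i s)
    (s : Fin S) :
    G.robustValue π i s ≤ G.nviV P E 0 i s + H * (6 * lam * M + 2 * κ₀) := by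
  have hne : Nonempty (Fin S) := ⟨s⟩
  have hσ := (G.level_pos i).le
  have hq : ∀ (h : Fin H) s a, ∃ q ∈ tvBall (G.level i) (G.nominal h s a),
      q ⬝ᵥ G.nviV P E (h + 1) i = worstCase (G.level i) (G.nominal h s a) (G.nviV P E (h + 1) i) :=
    fun h s a => by
      obtain ⟨q, h1, h2, -⟩ := exists_worstCase_eq (G.nominal_mem h s a) hσ (G.nviV P E (h + 1) i)
      exact ⟨q, h1, h2⟩
  choose q hqmem hqV using hq
  have hmax : ∀ h, ∃ s₀, ∀ s, G.nviV P E h i s ≤ G.nviV P E h i s₀ := fun h => Finite.exists_max _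
  choose top htop using hmax
  have key := le_of_potential (H := H) (κ₀ := κ₀) hlam hM π (q := q)
    (fun h s a => (hqmem h s a).1)
    (b := fun h s a => |worstCase (G.level i) (G.nominal h s a) (G.nviV P E (h + 1) i)
      - worstCase (G.level i) (P h s a) (G.nviV P E (h + 1) i)|)
    (W := fun h s => G.nviV P E h i (top h) - G.nviV P E h i s)
    (D := fun h s => G.policyValue π q i h s - G.nviV P E h i s)
    (fun _ _ _ => abs_nonneg _) (fun h s => sub_nonneg.2 (htop h s))
    (fun h s => hspan h _ _) (fun s => by simp [nviV_of_le G P E le_rfl])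
    (fun s => by simp [nviV_of_le G P E le_rfl, policyValue_of_le G π q i le_rfl])
    (fun h s => ?_) (fun h s => ?_) (fun h s a => ?_) s
  · rw [← value_eq_policyValue G π (fun h s a => (hqmem h s a).1) i hH] at key
    have := robustValue_le_value G π (Q := q) hqmem s
    linarith
  · refine (sub_le_sub_left (hπ h s) _).trans ?_
    rw [← JointDist.expect_const (μ := π h s) (G.nviV P E h i (top h)), ← JointDist.expect_sub]
    refine JointDist.expect_mono fun a => ?_
    rw [dotProduct_const_sub (hqmem h s a).1, hqV]
    have h1 := nviV_le_of_forall_le G hP E i h.2 (htop (h + 1)) (top h)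
    have h2 := le_abs_self (worstCase (G.level i) (G.nominal h s a) (G.nviV P E (h + 1) i)
      - worstCase (G.level i) (P h s a) (G.nviV P E (h + 1) i))
    have h3 := (G.reward_mem i h s a).1
    simp only [nviQ, nviQStep]
    linarith
  · refine (sub_le_sub_left (hπ h s) _).trans ?_
    rw [policyValue_of_lt G π q i h.2, ← JointDist.expect_sub]
    refine JointDist.expect_mono fun a => ?_
    have h2 := le_abs_self (worstCase (G.level i) (G.nominal h s a) (G.nviV P E (h + 1) i)
      - worstCase (G.level i) (P h s a) (G.nviV P E (h + 1) i))
    have h3 : (q h s a ⬝ᵥ fun s' => G.policyValue π q i (h + 1) s' - G.nviV P E (h + 1) i s')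
        = q h s a ⬝ᵥ G.policyValue π q i (h + 1) - q h s a ⬝ᵥ G.nviV P E (h + 1) i :=
      dotProduct_sub _ _ _
    rw [h3, hqV]
    simp only [nviQ, nviQStep]
    linarith
  · rw [finVar_const_sub (hqmem h s a).1]
    exact worstCase_error_le hlam hspan hσM herr (hqmem h s a)

/-- The true robust value of the computed policy is at least the estimated value minus the
accumulated error. This holds against every kernel in the uncertainty set, and the potential
measures the distance of the estimated value from its minimum. -/
lemma nviV_le_robustValue (hH : 0 < H) (s : Fin S) :
    G.nviV P E 0 i s - H * (6 * lam * M + 2 * κ₀)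
      ≤ G.robustValue (fun h s => E (G.nviQ P E h s)) i s := by
  have hne : Nonempty (Fin S) := ⟨s⟩
  have hσ := (G.level_pos i).le
  set π : JointPolicy H S A := fun h s => E (G.nviQ P E h s) with hπ
  have hneU : Nonempty (G.uncertaintySet i) :=
    ⟨⟨G.nominal, fun h s a => mem_tvBall_self (G.nominal_mem h s a) hσ⟩⟩
  refine le_ciInf fun ⟨q, hqmem⟩ => ?_
  have hmin : ∀ h, ∃ s₀, ∀ s, G.nviV P E h i s₀ ≤ G.nviV P E h i s := fun h => Finite.exists_min _
  choose bot hbot using hmin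
  have key := le_of_potential (H := H) (κ₀ := κ₀) hlam hM π (q := q)
    (fun h s a => (hqmem h s a).1)
    (b := fun h s a => |worstCase (G.level i) (G.nominal h s a) (G.nviV P E (h + 1) i)
      - worstCase (G.level i) (P h s a) (G.nviV P E (h + 1) i)|)
    (W := fun h s => G.nviV P E h i s - G.nviV P E h i (bot h))
    (D := fun h s => G.nviV P E h i s - G.policyValue π q i h s)
    (fun _ _ _ => abs_nonneg _) (fun h s => sub_nonneg.2 (hbot h s))
    (fun h s => hspan h _ _) (fun s => by simp [nviV_of_le G P E le_rfl])
    (fun s => by simp [nviV_of_le G P E le_rfl, policyValue_of_le G π q i le_rfl])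
    (fun h s => ?_) (fun h s => ?_) (fun h s a => ?_) s
  · rw [← value_eq_policyValue G π (fun h s a => (hqmem h s a).1) i hH] at key
    simp only
    linarith
  · rw [nviV_of_lt G P E h.2 i s,
      ← JointDist.expect_const (μ := π h s) (G.nviV P E h i (bot h)), ← JointDist.expect_sub]
    refine JointDist.expect_mono fun a => ?_
    rw [dotProduct_sub_const (hqmem h s a).1]
    have h1 := le_nviV_of_forall_le G hP E i h.2 (hbot (h + 1)) (bot h)
    have h2 := neg_abs_le (worstCase (G.level i) (G.nominal h s a) (G.nviV P E (h + 1) i)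
      - worstCase (G.level i) (P h s a) (G.nviV P E (h + 1) i))
    have h3 := (G.reward_mem i h s a).2
    have h4 := worstCase_le (V := G.nviV P E (h + 1) i) (G.nominal_mem h s a) hσ (hqmem h s a)
    simp only [nviQ, nviQStep]
    linarith
  · rw [nviV_of_lt G P E h.2 i s, policyValue_of_lt G π q i h.2, ← JointDist.expect_sub]
    refine JointDist.expect_mono fun a => ?_
    have h2 := neg_abs_le (worstCase (G.level i) (G.nominal h s a) (G.nviV P E (h + 1) i)
      - worstCase (G.level i) (P h s a) (G.nviV P E (h + 1) i))
    have h3 : (q h s a ⬝ᵥ fun s' => G.nviV P E (h + 1) i s' - G.policyValue π q i (h + 1) s')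
        = q h s a ⬝ᵥ G.nviV P E (h + 1) i - q h s a ⬝ᵥ G.policyValue π q i (h + 1) :=
      dotProduct_sub _ _ _
    have h4 := worstCase_le (V := G.nviV P E (h + 1) i) (G.nominal_mem h s a) hσ (hqmem h s a)
    rw [h3]
    simp only [nviQ, nviQStep]
    linarith
  · rw [finVar_sub_const (hqmem h s a).1]
    exact worstCase_error_le hlam hspan hσM herr (hqmem h s a)

end Deterministic

end RobustMarkovGame

/-! ### Sample complexity of DR-NVI -/

namespace RobustMarkovGame

variable {n H S N : ℕ} {A : Fin n → ℕ} {G : RobustMarkovGame n H S A}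

lemma gapResponse_le (hn : 0 < n) (hS : 0 < S) (hA : ∀ i, 0 < A i) {π : JointPolicy H S A} {ε : ℝ}
    (h : ∀ i π' s, G.robustValue (deviate π i π') i s ≤ G.robustValue π i s + ε) :
    G.gapResponse π ≤ ε := by
  have : Nonempty (Fin n × Fin S) := ⟨(⟨0, hn⟩, ⟨0, hS⟩)⟩
  refine ciSup_le fun x => sub_le_iff_le_add'.2 ?_
  have : Nonempty (Fin H → Fin S → stdSimplex ℝ (Fin (A x.1))) :=
    ⟨fun _ _ => ⟨_, single_mem_stdSimplex ℝ ⟨0, hA x.1⟩⟩⟩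
  exact ciSup_le fun π' => h x.1 π' x.2

lemma gapCE_le (hn : 0 < n) (hS : 0 < S) {π : JointPolicy H S A} {ε : ℝ}
    (h : ∀ i f s, G.robustValue (strategyModify π i f) i s ≤ G.robustValue π i s + ε) :
    G.gapCE π ≤ ε := by
  have : Nonempty (Fin n × Fin S) := ⟨(⟨0, hn⟩, ⟨0, hS⟩)⟩
  refine ciSup_le fun x => sub_le_iff_le_add'.2 ?_
  have : Nonempty (Fin H → Fin S → Fin (A x.1) → Fin (A x.1)) := ⟨fun _ _ => id⟩
  exact ciSup_le fun f => h x.1 f x.2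

lemma min_le_effectiveHorizon (G : RobustMarkovGame n H S A) (i : Fin n) :
    min (H : ℝ) (1 / G.level i) ≤ G.effectiveHorizon := by
  have : Nonempty (Fin n) := ⟨i⟩
  obtain ⟨j, hj⟩ := exists_eq_ciInf_of_finite (f := G.level)
  refine min_le_min le_rfl (one_div_le_one_div_of_le ?_ (ciInf_le (Finite.bddBelow_range _) i))
  exact hj ▸ G.level_pos j

lemma one_le_effectiveHorizon (hn : 0 < n) (hH : 0 < H) (hlevel : ∀ i, G.level i ≤ 1) :
    1 ≤ G.effectiveHorizon := by
  refine le_trans ?_ (min_le_effectiveHorizon G ⟨0, hn⟩)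
  refine le_min (by exact_mod_cast hH) ?_
  rw [le_div_iff₀ (G.level_pos _), one_mul]
  exact hlevel _

lemma effectiveHorizon_le (G : RobustMarkovGame n H S A) : G.effectiveHorizon ≤ H := min_le_left _ _

/-- Once the one-step errors are controlled, no policy that is no better than the computed
equilibrium for the estimated payoffs gains more than `ε` in the true robust game. -/
lemma robustValue_le_of_error (hN : 0 < N) (hH : 0 < H) (hlevel : ∀ i, G.level i ≤ 1)
    {E : EquilibriumRoutine A} {D : Dataset N H S A} {ε lam κ₀ : ℝ} (hlam : 0 ≤ lam)
    (hlamM : 4 * lam * G.effectiveHorizon ≤ 1)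
    (hε : 2 * (H * (6 * lam * G.effectiveHorizon + 2 * κ₀)) ≤ ε)
    (herr : ∀ i (h : Fin H) s a,
      |worstCase (G.level i) (G.nominal h s a) (G.nviV (empirical D) E (h + 1) i)
        - worstCase (G.level i) (empirical D h s a) (G.nviV (empirical D) E (h + 1) i)|
        ≤ lam * finVar (G.nominal h s a) (G.nviV (empirical D) E (h + 1) i) + κ₀)
    (i : Fin n) (π : JointPolicy H S A)
    (hπ : ∀ (h : Fin H) s, JointDist.expect (π h s) (G.nviQ (empirical D) E h s i)
      ≤ JointDist.expect (G.drNVI E D h s) (G.nviQ (empirical D) E h s i)) (s : Fin S) :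
    G.robustValue π i s ≤ G.robustValue (G.drNVI E D) i s + ε := by
  set M := min (H : ℝ) (1 / G.level i)
  have hσ := G.level_pos i
  have hM0 : 0 ≤ M := le_min (Nat.cast_nonneg H) (by positivity)
  have hMle : M ≤ G.effectiveHorizon := min_le_effectiveHorizon G i
  have hlm : lam * M ≤ lam * G.effectiveHorizon := mul_le_mul_of_nonneg_left hMle hlam
  have hσM : G.level i * M ^ 2 ≤ M := by
    have h1 : G.level i * M ≤ 1 := by
      have h2 : M ≤ 1 / G.level i := min_le_right _ _
      rw [le_div_iff₀ hσ] at h2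
      linarith
    nlinarith
  have hM : 4 * lam * M ≤ 1 := by linarith
  have hspan := nviV_sub_le G (empirical_mem hN D) E i (hlevel i)
  have hup := robustValue_le_nviV (empirical_mem hN D) hlam hM hspan hσM (herr i) hH π
    (fun h s => by rw [nviV_of_lt G _ E h.2]; exact hπ h s) s
  have hlo := nviV_le_robustValue (empirical_mem hN D) hlam hM hspan hσM (herr i) hH s
  change _ ≤ G.robustValue (G.drNVI E D) i s at hlo
  have h3 : (H : ℝ) * (lam * M) ≤ H * (lam * G.effectiveHorizon) :=
    mul_le_mul_of_nonneg_left hlm (Nat.cast_nonneg H)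
  linarith

end RobustMarkovGame

/-- With `τ = 2 log (18 S ∏ A n H N / δ)` the union bound costs at most `δ`. -/
lemma union_bound_le {s a n h N δ : ℝ} (hs : 1 ≤ s) (ha : 1 ≤ a) (hn : 1 ≤ n) (hh : 1 ≤ h)
    (hN : 1 ≤ N) (hδ : 0 < δ) (hδ1 : δ < 1) :
    (n * h * s * a * s) * (2 * Real.exp (-(2 * Real.log (18 * s * a * n * h * N / δ)))) ≤ δ := by
  set x := 18 * s * a * n * h * N / δ with hx
  have hx0 : 0 < x := by positivity
  have h1 : Real.exp (-(2 * Real.log x)) = (x ^ 2)⁻¹ := by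
    rw [Real.exp_neg, two_mul, Real.exp_add, Real.exp_log hx0, sq]
  have hy : 1 ≤ n * h * a := one_le_mul_of_one_le_of_one_le (one_le_mul_of_one_le_of_one_le hn hh) ha
  have hN2 : 1 ≤ N ^ 2 := one_le_pow₀ hN
  have h2 : n * h * s * a * s * 2 * δ ≤ (18 * s * a * n * h * N) ^ 2 := by
    calc n * h * s * a * s * 2 * δ = s ^ 2 * (2 * (δ * (n * h * a))) := by ring
      _ ≤ s ^ 2 * (324 * ((n * h * a) ^ 2 * N ^ 2)) := by
          refine mul_le_mul_of_nonneg_left ?_ (sq_nonneg _)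
          have h3 : δ * (n * h * a) ≤ 1 * (n * h * a) :=
            mul_le_mul_of_nonneg_right hδ1.le (by linarith)
          have h4 : (n * h * a) ≤ (n * h * a) ^ 2 := by nlinarith
          have h5 : (n * h * a) ^ 2 ≤ (n * h * a) ^ 2 * N ^ 2 :=
            le_mul_of_one_le_right (sq_nonneg _) hN2
          nlinarith [sq_nonneg (n * h * a)]
      _ = (18 * s * a * n * h * N) ^ 2 := by ring
  rw [h1, ← mul_assoc, ← div_eq_mul_inv, div_le_iff₀ (by positivity)]
  calc n * h * s * a * s * 2 = n * h * s * a * s * 2 * δ / δ := by field_simp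
    _ ≤ (18 * s * a * n * h * N) ^ 2 / δ := by gcongr
    _ = δ * x ^ 2 := by rw [hx]; field_simp

/-- The sample size condition makes the accumulated error at most `ε`, for the exponent
`λ = ε / (24 H M)` of the Chernoff bounds. -/
lemma accumulated_error_le {s a h N ε M L : ℝ} (hs : 0 < s) (ha : 0 < a) (hh : 0 < h)
    (hN : 0 < N) (hε : 0 < ε) (hM : 0 < M)
    (hsize : 384 * s * h ^ 3 * a / ε ^ 2 * M * L ≤ N * h * s * a) :
    2 * (h * (6 * (ε / (24 * h * M)) * M + 2 * (2 * L / (N * (ε / (24 * h * M)))))) ≤ ε := by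
  have h1 : 384 * h ^ 2 * M * L ≤ N * ε ^ 2 := by
    have h2 : 384 * s * h ^ 3 * a / ε ^ 2 * M * L = (384 * h ^ 2 * M * L / ε ^ 2) * (h * s * a) := by
      ring
    rw [h2, show N * h * s * a = N * (h * s * a) by ring] at hsize
    have h3 := le_of_mul_le_mul_right hsize (by positivity)
    rwa [div_le_iff₀ (by positivity)] at h3
  have h4 : 2 * (h * (6 * (ε / (24 * h * M)) * M + 2 * (2 * L / (N * (ε / (24 * h * M))))))
      = ε / 2 + (384 * h ^ 2 * M * L) / (2 * (N * ε)) := by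
    field_simp
    ring
  have h5 : (384 * h ^ 2 * M * L) / (2 * (N * ε)) ≤ ε / 2 := by
    rw [div_le_iff₀ (by positivity)]
    nlinarith
  rw [h4]
  linarith

theorem theorem1 :
    ∃ C₁ : ℝ, 0 < C₁ ∧
      ∀ (n H S N : ℕ) (A : Fin n → ℕ),
        0 < n → 0 < H → 0 < S → 0 < N → (∀ i, 0 < A i) →
      ∀ (G : RobustMarkovGame n H S A), (∀ i, G.level i ≤ 1) →
      ∀ (δ ε : ℝ), 0 < δ → δ < 1 → 0 < ε → ε ≤ Real.sqrt G.effectiveHorizon →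
        C₁ * (S : ℝ) * (H : ℝ) ^ 3 * (∏ i, (A i : ℝ)) / ε ^ 2 * G.effectiveHorizon
            * Real.log (18 * (S : ℝ) * (∏ i, (A i : ℝ)) * (n : ℝ) * (H : ℝ) * (N : ℝ) / δ)
          ≤ (N : ℝ) * (H : ℝ) * (S : ℝ) * ∏ i, (A i : ℝ) →
      ∀ {Ω : Type*} [MeasurableSpace Ω] (μ : Measure Ω) [IsProbabilityMeasure μ]
        (X : Ω → RobustMarkovGame.Dataset N H S A), G.IsGenerativeSample μ X →
      ∀ (E : EquilibriumRoutine A),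
        ((∀ q, JointDist.IsNash q (E q)) →
          1 - δ ≤ μ.real {ω | G.IsRobustNE ε (G.drNVI E (X ω))}) ∧
        ((∀ q, JointDist.IsCCE q (E q)) →
          1 - δ ≤ μ.real {ω | G.IsRobustCCE ε (G.drNVI E (X ω))}) ∧
        ((∀ q, JointDist.IsCE q (E q)) →
          1 - δ ≤ μ.real {ω | G.IsRobustCE ε (G.drNVI E (X ω))}) := by
  refine ⟨384, by norm_num, ?_⟩
  intro n H S N A hn hH hS hN hA G hlevel δ ε hδ hδ1 hε hεM hsize Ω _ μ _ X hX E
  set M := G.effectiveHorizon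
  have hM1 : 1 ≤ M := RobustMarkovGame.one_le_effectiveHorizon hn hH hlevel
  have hMH : M ≤ H := RobustMarkovGame.effectiveHorizon_le G
  have hH1 : (1 : ℝ) ≤ H := by exact_mod_cast hH
  have hS1 : (1 : ℝ) ≤ S := by exact_mod_cast hS
  have hN1 : (1 : ℝ) ≤ N := by exact_mod_cast hN
  have hn1 : (1 : ℝ) ≤ n := by exact_mod_cast hn
  have hA1 : 1 ≤ ∏ i, (A i : ℝ) := by
    rw [← Nat.cast_prod]
    exact_mod_cast Finset.prod_pos fun i _ => hA i
  have hεH : ε ≤ H := hεM.trans ((Real.sqrt_le_sqrt (hMH.trans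
    (by nlinarith : (H : ℝ) ≤ H ^ 2))).trans_eq (Real.sqrt_sq (by linarith)))
  set L := Real.log (18 * (S : ℝ) * (∏ i, (A i : ℝ)) * (n : ℝ) * (H : ℝ) * (N : ℝ) / δ)
  set lam := ε / (24 * H * M) with hlam
  have hlam0 : 0 < lam := by positivity
  have hlamM : lam * M ≤ 1 / 24 := by
    have : lam * M = ε / H / 24 := by rw [hlam]; field_simp
    rw [this]
    have : ε / H ≤ 1 := by rw [div_le_one (by linarith)]; exact hεH
    linarith
  have herror := accumulated_error_le (L := L) (s := S) (a := ∏ i, (A i : ℝ)) (h := H) (N := N)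
    (M := M) (by linarith) (by linarith) (by linarith) (by linarith) hε (by linarith) hsize
  have hprob := RobustMarkovGame.le_measureReal_worstCase_error hX hN hS hlevel E hlam0 (τ := 2 * L) fun i =>
    (mul_le_mul_of_nonneg_left (RobustMarkovGame.min_le_effectiveHorizon G i) hlam0.le).trans
      (hlamM.trans (by norm_num))
  have hunion := union_bound_le hS1 hA1 hn1 hH1 hN1 hδ hδ1
  have hgood : 1 - δ ≤ _ := (sub_le_sub_left hunion 1).trans hprob
  have hvalue := fun (ω : Ω) herr => RobustMarkovGame.robustValue_le_of_error (D := X ω) (E := E) (ε := ε)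
    (κ₀ := 2 * L / (N * lam)) hN hH hlevel hlam0.le (by linarith) herror herr
  refine ⟨fun hE => hgood.trans (measureReal_mono fun ω hω => ⟨fun h s => (hE _).1, ?_⟩),
    fun hE => hgood.trans (measureReal_mono fun ω hω => ?_),
    fun hE => hgood.trans (measureReal_mono fun ω hω => ?_)⟩
  · exact RobustMarkovGame.gapResponse_le hn hS hA fun i π' s =>
      hvalue ω hω i _ (fun h s => (hE _).2 i (π' h s)) s
  · exact RobustMarkovGame.gapResponse_le hn hS hA fun i π' s =>
      hvalue ω hω i _ (fun h s => hE _ i (π' h s)) s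
  · exact RobustMarkovGame.gapCE_le hn hS fun i f s => hvalue ω hω i _ (fun h s => hE _ i (f h s)) s
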